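/- **Setting.** Let $\mathbf V$ be an N–anholonomic manifold: a smooth manifold of dimension $n+m$ with a local fibred structure, whose vertical bundle $v\mathbf V\subset T\mathbf V$ consists locally of the kernels of the differential of a submersion to $\mathbb R^n$, and with an N–connection, i.e. a smooth bundle morphism $\mathbf N:T\mathbf V\to v\mathbf V$ that is the identity on $v\mathbf V$ (so that $T\mathbf V=h\mathbf V\oplus_N v\mathbf V$). A *d–object* is a couple consisting of a horizontal ($h$) and a vertical ($v$) component, and *N–adapted* means preserving the two components. Let $k\ge 1$, let $\mathbb Z_k\subset U(1)$ be the group of $k$-th roots of unity, and let $\mathbf G=(G,{}^\bullet G)$ and $\check{\mathbf G}=(\check G,{}^\bullet\check G)$ be finite-dimensional Lie d–groups (couples of Lie groups) with central extensions of Lie groups $$0\to\mathbb Z_k\to\check G\to G\to 1,\qquad 0\to\mathbb Z_k\to{}^\bullet\check G\to{}^\bullet G\to 1,$$ where $\check G\to G$ and ${}^\bullet\check G\to{}^\bullet G$ are principal $\mathbb Z_k$-bundles (coverings). Let $\pi:\mathbf B\to\mathbf V$ be a smooth principal bundle with structure d–group $\mathbf G$ (that is, with group $G\times{}^\bullet G$).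 The d–group $\check{\mathbf G}$ (that is, $\check G\times{}^\bullet\check G$) acts on $\mathbf B$ through $\mathbf G$ by $\check{\mathbf g}\cdot b=b\,\mathbf g^{-1}$, where $\mathbf g$ is the image of $\check{\mathbf g}$ in $\mathbf G$; all isotropy groups are $\mathbb Z_k\times\mathbb Z_k$. Let $\mathbf\Psi$ be the associated lifting N–anholonomic bundle gerbe. For $q\in\mathbb Z$, an *N–anholonomic $\mathbf\Psi^q$–module* is a smooth $\check{\mathbf G}$–equivariant complex vector bundle $\mathbf W=hW\oplus vW\to\mathbf B$ of finite rank, with $\check{\mathbf G}$ acting linearly on the fibres and preserving the decomposition, on which the isotropy d–group acts with weight $q$: $(z,z')\in\mathbb Z_k\times\mathbb Z_k$ acts on $hW$ as multiplication by $z^q$ and on $vW$ as multiplication by $z'^{\,q}$. A *d–bundle* on $\mathbf V$ is a smooth complex vector bundle of finite rank with a decomposition $\mathbf E=hE\oplus vE$. Morphisms of d–bundles on $\mathbf V$ are the smooth N–adapted linear bundle maps over the identity of $\mathbf V$; morphisms of modules are the smooth N–adapted linear bundle maps over the identity of $\mathbf B$ that are $\check{\mathbf G}$–equivariant. The fibre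 rank may vary between connected components. **Proposition.** 1. $\mathbf\Psi^0$–modules and d–bundles on $\mathbf V$ are in bijective correspondence: for every d–bundle $\mathbf E$ on $\mathbf V$ the pull-back $\pi^*\mathbf E$, with its tautological $\check{\mathbf G}$–action, is a $\mathbf\Psi^0$–module; every $\mathbf\Psi^0$–module is isomorphic to $\pi^*\mathbf E$ for some d–bundle $\mathbf E$; and for all d–bundles $\mathbf E,\mathbf E'$ one has $\mathbf E\cong\mathbf E'$ if and only if $\pi^*\mathbf E\cong\pi^*\mathbf E'$, while $f\mapsto\pi^*f$ is a bijection from the morphisms $\mathbf E\to\mathbf E'$ onto the morphisms $\pi^*\mathbf E\to\pi^*\mathbf E'$ of modules. 2. For every $q\in\mathbb Z$ and every $\mathbf\Psi^q$–module $\mathbf W$, the bundle of N–adapted endomorphisms $\mathrm{End}(hW)\oplus\mathrm{End}(vW)$, with the action by conjugation, is a $\mathbf\Psi^0$–module. 3. For every $q\in\mathbb Z$, the direct sum $(hW\oplus hW')\oplus(vW\oplus vW')$ of two $\mathbf\Psi^q$–modules is a $\mathbf\Psi^q$–module. 4. For all $q_1,q_2\in\mathbb Z$, the d–tensor product $(hW\otimes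 hW')\oplus(vW\otimes vW')$ of a $\mathbf\Psi^{q_1}$–module $\mathbf W$ and a $\mathbf\Psi^{q_2}$–module $\mathbf W'$ is a $\mathbf\Psi^{q_1+q_2}$–module. -/

import Mathlib

open scoped Manifold ContDiff TensorProduct

universe u v w w₁ w₂

noncomputable section

namespace NGerbe

/-! ## N-connections -/

/-- A nonlinear connection on a smooth manifold `V` of dimension `n + m` with a local fibred
structure. The vertical spaces `vert x ⊆ T_x V` are the kernels of the differentials of local
submersions to `ℝⁿ`; the connection is a smooth morphism `N : TV → vV` of vector bundles which is
the identity on `vV` (a left splitting of `0 → vV → TV → TV/vV → 0`).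
Then `TV = hV ⊕ vV` with `hV = ker N`. -/
structure NConnection (n m : ℕ) (V : Type*) [TopologicalSpace V]
    [ChartedSpace (EuclideanSpace ℝ (Fin (n + m))) V] [IsManifold (𝓡 (n + m)) ∞ V] where
  vert : ∀ x : V, Submodule ℝ (TangentSpace (𝓡 (n + m)) x)
  locally_fibred : ∀ x : V, ∃ (U : Set V) (pr : V → EuclideanSpace ℝ (Fin n)),
    IsOpen U ∧ x ∈ U ∧ ContMDiffOn (𝓡 (n + m)) (𝓡 n) ∞ pr U ∧
    ∀ y ∈ U, Function.Surjective (mfderiv (𝓡 (n + m)) (𝓡 n) pr y) ∧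
      vert y = LinearMap.ker (mfderiv (𝓡 (n + m)) (𝓡 n) pr y).toLinearMap
  N : ∀ x : V, TangentSpace (𝓡 (n + m)) x →L[ℝ] TangentSpace (𝓡 (n + m)) x
  N_mem : ∀ x X, N x X ∈ vert x
  N_vert : ∀ x, ∀ X ∈ vert x, N x X = X
  smooth_N : ContMDiff (𝓡 (n + m)).tangent (𝓡 (n + m)).tangent ∞
    (fun X : TangentBundle (𝓡 (n + m)) V =>
      (⟨X.proj, N X.proj X.2⟩ : TangentBundle (𝓡 (n + m)) V))

/-! ## Central extensions and principal bundles -/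

/-- A central extension `0 → ℤ_k → Gc → G → 1` of Lie groups, where `ℤ_k ⊂ U(1)` is the group of
`k`-th roots of unity. The projection is a local diffeomorphism, i.e. `Gc → G` is a principal
`ℤ_k`-bundle. -/
structure CentralExtension (k : ℕ)
    (E₁ : Type*) [NormedAddCommGroup E₁] [NormedSpace ℝ E₁]
    (Gc : Type*) [TopologicalSpace Gc] [ChartedSpace E₁ Gc] [Group Gc] [LieGroup 𝓘(ℝ, E₁) ∞ Gc]
    (E₂ : Type*) [NormedAddCommGroup E₂] [NormedSpace ℝ E₂]
    (G : Type*) [TopologicalSpace G] [ChartedSpace E₂ G] [Group G] [LieGroup 𝓘(ℝ, E₂) ∞ G] where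
  incl : rootsOfUnity k ℂ →* Gc
  pr : Gc →* G
  incl_injective : Function.Injective incl
  incl_central : ∀ z g, incl z * g = g * incl z
  exact : pr.ker = incl.range
  pr_surjective : Function.Surjective pr
  pr_localDiffeo : IsLocalDiffeomorph 𝓘(ℝ, E₁) 𝓘(ℝ, E₂) ∞ pr

/-- A smooth principal `G`-bundle `proj : B → V`, with right action `b, g ↦ act b g`. In
`locally_trivial`, `b ↦ (proj b, φ b)` is an equivariant diffeomorphism of `proj⁻¹ U` onto `U × G`
with inverse `(x, g) ↦ act (s x) g`. -/
structure PrincipalBundle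
    {EV HV : Type*} [NormedAddCommGroup EV] [NormedSpace ℝ EV] [TopologicalSpace HV]
    (IV : ModelWithCorners ℝ EV HV)
    {EB HB : Type*} [NormedAddCommGroup EB] [NormedSpace ℝ EB] [TopologicalSpace HB]
    (IB : ModelWithCorners ℝ EB HB)
    {EG HG : Type*} [NormedAddCommGroup EG] [NormedSpace ℝ EG] [TopologicalSpace HG]
    (IG : ModelWithCorners ℝ EG HG)
    (V : Type*) [TopologicalSpace V] [ChartedSpace HV V] [IsManifold IV ∞ V]
    (B : Type*) [TopologicalSpace B] [ChartedSpace HB B] [IsManifold IB ∞ B]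
    (G : Type*) [TopologicalSpace G] [ChartedSpace HG G] [Group G] [LieGroup IG ∞ G] where
  proj : B → V
  act : B → G → B
  act_one : ∀ b, act b 1 = b
  act_mul : ∀ b g h, act b (g * h) = act (act b g) h
  proj_act : ∀ b g, proj (act b g) = proj b
  smooth_proj : ContMDiff IB IV ∞ proj
  smooth_act : ContMDiff (IB.prod IG) IB ∞ (fun p : B × G => act p.1 p.2)
  locally_trivial : ∀ x : V, ∃ (U : Set V) (s : V → B) (φ : B → G),
    IsOpen U ∧ x ∈ U ∧ ContMDiffOn IV IB ∞ s U ∧ ContMDiffOn IB IG ∞ φ (proj ⁻¹' U) ∧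
    (∀ y ∈ U, proj (s y) = y ∧ φ (s y) = 1) ∧
    (∀ b ∈ proj ⁻¹' U, act (s (proj b)) (φ b) = b ∧ ∀ g, φ (act b g) = φ b * g)

/-! ## Complex vector bundles -/

/-- A local frame `vec i` over `dom`, with the dual coframe `coord i`. Values outside `dom` are
irrelevant. -/
structure LocalFrame {M : Type v} (F : M → Type w) [∀ x, AddCommGroup (F x)]
    [∀ x, Module ℂ (F x)] where
  κ : Type
  [fin : Fintype κ]
  dom : Set M
  vec : κ → ∀ x, F x
  coord : κ → ∀ x, F x →ₗ[ℂ] ℂ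

attribute [instance] LocalFrame.fin

/-- A family of complex vector spaces over `M` with a collection of local frames: the data of a
vector bundle. The axioms are in `FramedFamily.IsBundle`. -/
structure FramedFamily (M : Type v) where
  Fiber : M → Type w
  [addCommGroup : ∀ x, AddCommGroup (Fiber x)]
  [module : ∀ x, Module ℂ (Fiber x)]
  atlas : Set (LocalFrame Fiber)

attribute [instance] FramedFamily.addCommGroup FramedFamily.module

section Bundles

variable {EM HM : Type*} [NormedAddCommGroup EM] [NormedSpace ℝ EM] [TopologicalSpace HM]
  (I : ModelWithCorners ℝ EM HM) {M : Type v} [TopologicalSpace M] [ChartedSpace HM M]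

/-- `E` is a smooth complex vector bundle of finite rank over `M`: the domains of the local frames
are open and cover `M`, each frame is a basis of every fibre over its domain, and the transition
matrices are smooth. -/
structure FramedFamily.IsBundle (E : FramedFamily.{v, w} M) : Prop where
  isOpen_dom : ∀ c ∈ E.atlas, IsOpen c.dom
  cover : ∀ x, ∃ c ∈ E.atlas, x ∈ c.dom
  span : ∀ c ∈ E.atlas, ∀ x ∈ c.dom, ∀ e : E.Fiber x, ∑ i, c.coord i x e • c.vec i x = e
  dual : ∀ c ∈ E.atlas, ∀ x ∈ c.dom, ∀ (a : c.κ → ℂ) (i : c.κ),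
    c.coord i x (∑ j, a j • c.vec j x) = a i
  smooth_transition : ∀ c ∈ E.atlas, ∀ d ∈ E.atlas, ∀ (i : d.κ) (j : c.κ),
    ContMDiffOn I 𝓘(ℝ, ℂ) ∞ (fun x => d.coord i x (c.vec j x)) (c.dom ∩ d.dom)

/-- The fibrewise linear map `f : E → E'` over the identity of `M` is smooth. -/
def FramedFamily.IsSmoothHom (E : FramedFamily.{v, w₁} M) (E' : FramedFamily.{v, w₂} M)
    (f : ∀ x, E.Fiber x →ₗ[ℂ] E'.Fiber x) : Prop :=
  ∀ c ∈ E.atlas, ∀ d ∈ E'.atlas, ∀ (i : d.κ) (j : c.κ),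
    ContMDiffOn I 𝓘(ℝ, ℂ) ∞ (fun x => d.coord i x (f x (c.vec j x))) (c.dom ∩ d.dom)

end Bundles

section Constructions

variable {M : Type v}

/-- The identification of the fibres over equal points. -/
def FramedFamily.castFiber (E : FramedFamily.{v, w} M) {x y : M} (h : x = y) :
    E.Fiber x ≃ₗ[ℂ] E.Fiber y :=
  h ▸ LinearEquiv.refl ℂ (E.Fiber x)

/-- The pull-back of a bundle along a map. -/
def FramedFamily.pullback {B : Type u} (f : B → M) (E : FramedFamily.{v, w} M) :
    FramedFamily.{u, w} B where
  Fiber b := E.Fiber (f b)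
  atlas := { p | ∃ c ∈ E.atlas, p =
    { κ := c.κ
      dom := f ⁻¹' c.dom
      vec := fun i b => c.vec i (f b)
      coord := fun i b => c.coord i (f b) } }

/-- The direct sum of two bundles. -/
def FramedFamily.sum (E : FramedFamily.{v, w₁} M) (E' : FramedFamily.{v, w₂} M) :
    FramedFamily.{v, max w₁ w₂} M where
  Fiber x := E.Fiber x × E'.Fiber x
  atlas := { p | ∃ c ∈ E.atlas, ∃ d ∈ E'.atlas, p =
    { κ := c.κ ⊕ d.κ
      dom := c.dom ∩ d.dom
      vec := fun i x => Sum.elim (fun i => (c.vec i x, 0)) (fun j => (0, d.vec j x)) i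
      coord := fun i x => Sum.elim
        (fun i => (c.coord i x).comp (LinearMap.fst ℂ (E.Fiber x) (E'.Fiber x)))
        (fun j => (d.coord j x).comp (LinearMap.snd ℂ (E.Fiber x) (E'.Fiber x))) i } }

/-- The tensor product of two bundles. -/
def FramedFamily.tensor (E : FramedFamily.{v, w₁} M) (E' : FramedFamily.{v, w₂} M) :
    FramedFamily.{v, max w₁ w₂} M where
  Fiber x := E.Fiber x ⊗[ℂ] E'.Fiber x
  atlas := { p | ∃ c ∈ E.atlas, ∃ d ∈ E'.atlas, p =
    { κ := c.κ × d.κ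
      dom := c.dom ∩ d.dom
      vec := fun i x => c.vec i.1 x ⊗ₜ[ℂ] d.vec i.2 x
      coord := fun i x => (TensorProduct.lid ℂ ℂ).toLinearMap.comp
        (TensorProduct.map (c.coord i.1 x) (d.coord i.2 x)) } }

/-- The bundle of endomorphisms of a bundle, framed by the elementary matrices in the local
frames. -/
def FramedFamily.endo (E : FramedFamily.{v, w} M) : FramedFamily.{v, w} M where
  Fiber x := E.Fiber x →ₗ[ℂ] E.Fiber x
  atlas := { p | ∃ c ∈ E.atlas, p =
    { κ := c.κ × c.κ
      dom := c.dom
      vec := fun i x => (c.coord i.2 x).smulRight (c.vec i.1 x)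
      coord := fun i x => (c.coord i.1 x).comp (LinearMap.applyₗ (c.vec i.2 x)) } }

end Constructions

/-! ## Equivariant bundles -/

/-- A framed family over `B` with linear isomorphisms `W_b → W_{b'}`, `b' = a g b`, that lift a map
`a : Γ → B → B` (below: a left action of a Lie group): the data of an equivariant bundle. The
axioms are in `EquivariantFamily.IsBundle`. -/
structure EquivariantFamily {Γ B : Type*} (a : Γ → B → B) extends FramedFamily.{_, w} B where
  act : ∀ (g : Γ) (b b' : B), b' = a g b → (Fiber b ≃ₗ[ℂ] Fiber b')

section Equivariant

variable {EB HB : Type*} [NormedAddCommGroup EB] [NormedSpace ℝ EB] [TopologicalSpace HB]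
  (IB : ModelWithCorners ℝ EB HB) {B : Type v} [TopologicalSpace B] [ChartedSpace HB B]
  {EΓ HΓ : Type*} [NormedAddCommGroup EΓ] [NormedSpace ℝ EΓ] [TopologicalSpace HΓ]
  (IΓ : ModelWithCorners ℝ EΓ HΓ) {Γ : Type u} [TopologicalSpace Γ] [ChartedSpace HΓ Γ] [Group Γ]
  {a : Γ → B → B}

/-- `W` is a `Γ`-equivariant smooth complex vector bundle over `B`: a smooth vector bundle with a
smooth action of `Γ` by fibrewise linear maps which lifts the action `a` on `B`. -/
structure EquivariantFamily.IsBundle (W : EquivariantFamily.{w} a) : Prop where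
  isBundle : W.toFramedFamily.IsBundle IB
  act_one : ∀ (b : B) (h : b = a 1 b) (e : W.Fiber b), W.act 1 b b h e = e
  act_mul : ∀ (g g' : Γ) (b b' b'' : B) (h' : b' = a g' b) (h : b'' = a g b')
    (h'' : b'' = a (g * g') b) (e : W.Fiber b),
    W.act (g * g') b b'' h'' e = W.act g b' b'' h (W.act g' b b' h' e)
  smooth_act : ∀ c ∈ W.atlas, ∀ d ∈ W.atlas, ∀ (i : d.κ) (j : c.κ),
    ContMDiffOn (IΓ.prod IB) 𝓘(ℝ, ℂ) ∞
      (fun p : Γ × B => d.coord i (a p.1 p.2) (W.act p.1 p.2 _ rfl (c.vec j p.2)))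
      { p | p.2 ∈ c.dom ∧ a p.1 p.2 ∈ d.dom }

/-- The fibrewise linear map `f : W → W'` over the identity of `B` is smooth and equivariant. -/
def EquivariantFamily.IsEquivariantHom (W : EquivariantFamily.{w₁} a)
    (W' : EquivariantFamily.{w₂} a) (f : ∀ b, W.Fiber b →ₗ[ℂ] W'.Fiber b) : Prop :=
  W.toFramedFamily.IsSmoothHom IB W'.toFramedFamily f ∧
  ∀ (g : Γ) (b b' : B) (h : b' = a g b) (e : W.Fiber b),
    f b' (W.act g b b' h e) = W'.act g b b' h (f b e)

/-- The direct sum of equivariant bundles, with `g (e, e') = (g e, g e')`. -/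
def EquivariantFamily.sum (W : EquivariantFamily.{w₁} a) (W' : EquivariantFamily.{w₂} a) :
    EquivariantFamily.{max w₁ w₂} a where
  toFramedFamily := W.toFramedFamily.sum W'.toFramedFamily
  act g b b' h := (W.act g b b' h).prodCongr (W'.act g b b' h)

/-- The tensor product of equivariant bundles, with `g (e ⊗ e') = g e ⊗ g e'`. -/
def EquivariantFamily.tensor (W : EquivariantFamily.{w₁} a) (W' : EquivariantFamily.{w₂} a) :
    EquivariantFamily.{max w₁ w₂} a where
  toFramedFamily := W.toFramedFamily.tensor W'.toFramedFamily
  act g b b' h := TensorProduct.congr (W.act g b b' h) (W'.act g b b' h)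

/-- The endomorphism bundle of an equivariant bundle, with the action by conjugation. -/
def EquivariantFamily.endo (W : EquivariantFamily.{w} a) : EquivariantFamily.{w} a where
  toFramedFamily := W.toFramedFamily.endo
  act g b b' h := (W.act g b b' h).conj

end Equivariant

/-! ## d-objects: couples of a horizontal and a vertical component -/

/-- A bundle of d-vector spaces `W = hW ⊕ vW` over `M` (data). -/
structure DFamily (M : Type v) where
  h : FramedFamily.{v, w} M
  v : FramedFamily.{v, w} M

/-- An equivariant bundle of d-vector spaces `W = hW ⊕ vW` whose group action preserves the
decomposition (data). -/
structure EquivariantDFamily {Γ B : Type*} (a : Γ → B → B) where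
  h : EquivariantFamily.{w} a
  v : EquivariantFamily.{w} a

/-- An N-adapted (that is, `h ⊕ v`-preserving) fibrewise linear map of d-bundles. -/
structure DFamily.Hom {M : Type v} (E : DFamily.{v, w₁} M) (E' : DFamily.{v, w₂} M) where
  h : ∀ x, E.h.Fiber x →ₗ[ℂ] E'.h.Fiber x
  v : ∀ x, E.v.Fiber x →ₗ[ℂ] E'.v.Fiber x

section DBundles

variable {EM HM : Type*} [NormedAddCommGroup EM] [NormedSpace ℝ EM] [TopologicalSpace HM]
  (I : ModelWithCorners ℝ EM HM) {M : Type v} [TopologicalSpace M] [ChartedSpace HM M]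

/-- `E = hE ⊕ vE` is a smooth bundle of d-vector spaces. -/
def DFamily.IsBundle (E : DFamily.{v, w} M) : Prop := E.h.IsBundle I ∧ E.v.IsBundle I

def DFamily.IsSmoothHom {E : DFamily.{v, w₁} M} {E' : DFamily.{v, w₂} M} (f : E.Hom E') : Prop :=
  E.h.IsSmoothHom I E'.h f.h ∧ E.v.IsSmoothHom I E'.v f.v

/-- `E` and `E'` are isomorphic as smooth d-bundles. -/
def DFamily.Isomorphic (E : DFamily.{v, w₁} M) (E' : DFamily.{v, w₂} M) : Prop :=
  ∃ (f : E.Hom E') (g : E'.Hom E), IsSmoothHom I f ∧ IsSmoothHom I g ∧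
    (∀ x, (∀ e, g.h x (f.h x e) = e) ∧ (∀ e, f.h x (g.h x e) = e)) ∧
    (∀ x, (∀ e, g.v x (f.v x e) = e) ∧ (∀ e, f.v x (g.v x e) = e))

end DBundles

section EquivariantDBundles

variable {EB HB : Type*} [NormedAddCommGroup EB] [NormedSpace ℝ EB] [TopologicalSpace HB]
  (IB : ModelWithCorners ℝ EB HB) {B : Type v} [TopologicalSpace B] [ChartedSpace HB B]
  {Γ : Type u} {a : Γ → B → B}

/-- The underlying d-bundle. -/
def EquivariantDFamily.toDFamily (W : EquivariantDFamily.{w} a) : DFamily.{v, w} B :=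
  ⟨W.h.toFramedFamily, W.v.toFramedFamily⟩

def EquivariantDFamily.IsEquivariantHom {W : EquivariantDFamily.{w₁} a}
    {W' : EquivariantDFamily.{w₂} a} (f : W.toDFamily.Hom W'.toDFamily) : Prop :=
  W.h.IsEquivariantHom IB W'.h f.h ∧ W.v.IsEquivariantHom IB W'.v f.v

/-- `W` and `W'` are isomorphic as equivariant d-bundles. -/
def EquivariantDFamily.Isomorphic (W : EquivariantDFamily.{w₁} a)
    (W' : EquivariantDFamily.{w₂} a) : Prop :=
  ∃ (f : W.toDFamily.Hom W'.toDFamily) (g : W'.toDFamily.Hom W.toDFamily),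
    IsEquivariantHom IB f ∧ IsEquivariantHom IB g ∧
    (∀ x, (∀ e, g.h x (f.h x e) = e) ∧ (∀ e, f.h x (g.h x e) = e)) ∧
    (∀ x, (∀ e, g.v x (f.v x e) = e) ∧ (∀ e, f.v x (g.v x e) = e))

/-- The direct sum of d-bundles: `(hW ⊕ hW') ⊕ (vW ⊕ vW')`. -/
def EquivariantDFamily.sum (W : EquivariantDFamily.{w₁} a) (W' : EquivariantDFamily.{w₂} a) :
    EquivariantDFamily.{max w₁ w₂} a :=
  ⟨W.h.sum W'.h, W.v.sum W'.v⟩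

/-- The d-tensor product: `(hW ⊗ hW') ⊕ (vW ⊗ vW')`. -/
def EquivariantDFamily.dTensor (W : EquivariantDFamily.{w₁} a) (W' : EquivariantDFamily.{w₂} a) :
    EquivariantDFamily.{max w₁ w₂} a :=
  ⟨W.h.tensor W'.h, W.v.tensor W'.v⟩

/-- The bundle of N-adapted endomorphisms, `End (hW) ⊕ End (vW)`: an endomorphism of
`hW ⊕ vW` is N-adapted if it preserves both summands. -/
def EquivariantDFamily.nEnd (W : EquivariantDFamily.{w} a) : EquivariantDFamily.{w} a :=
  ⟨W.h.endo, W.v.endo⟩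

end EquivariantDBundles

/-! ## Modules of weight `q` -/

section Modules

variable {k : ℕ}
  {EV HV : Type*} [NormedAddCommGroup EV] [NormedSpace ℝ EV] [TopologicalSpace HV]
  {IV : ModelWithCorners ℝ EV HV}
  {V : Type v} [TopologicalSpace V] [ChartedSpace HV V] [IsManifold IV ∞ V]
  {EB HB : Type*} [NormedAddCommGroup EB] [NormedSpace ℝ EB] [TopologicalSpace HB]
  {IB : ModelWithCorners ℝ EB HB}
  {B : Type u} [TopologicalSpace B] [ChartedSpace HB B] [IsManifold IB ∞ B]
  {E₁ : Type*} [NormedAddCommGroup E₁] [NormedSpace ℝ E₁]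
  {Gh : Type*} [TopologicalSpace Gh] [ChartedSpace E₁ Gh] [Group Gh] [LieGroup 𝓘(ℝ, E₁) ∞ Gh]
  {E₂ : Type*} [NormedAddCommGroup E₂] [NormedSpace ℝ E₂]
  {Gv : Type*} [TopologicalSpace Gv] [ChartedSpace E₂ Gv] [Group Gv] [LieGroup 𝓘(ℝ, E₂) ∞ Gv]
  {E₃ : Type*} [NormedAddCommGroup E₃] [NormedSpace ℝ E₃]
  {Gch : Type*} [TopologicalSpace Gch] [ChartedSpace E₃ Gch] [Group Gch]
  [LieGroup 𝓘(ℝ, E₃) ∞ Gch]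
  {E₄ : Type*} [NormedAddCommGroup E₄] [NormedSpace ℝ E₄]
  {Gcv : Type*} [TopologicalSpace Gcv] [ChartedSpace E₄ Gcv] [Group Gcv]
  [LieGroup 𝓘(ℝ, E₄) ∞ Gcv]

/-- The left action of the extended d-group `(Gch, Gcv)` on the total space of a principal bundle
for the d-group `(Gh, Gv)`: an element `g` acts by `b ↦ b · (pr g)⁻¹`. -/
def liftedAction (eh : CentralExtension k E₃ Gch E₁ Gh) (ev : CentralExtension k E₄ Gcv E₂ Gv)
    (P : PrincipalBundle IV IB (𝓘(ℝ, E₁).prod 𝓘(ℝ, E₂)) V B (Gh × Gv)) :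
    Gch × Gcv → B → B :=
  fun g b => P.act b (eh.pr g.1, ev.pr g.2)⁻¹

/-- `W → B` is an N-anholonomic `Ψ^q`-module for the lifting bundle gerbe `Ψ` of the principal
d-bundle `P` and the extension `(eh, ev)`: a `(Gch, Gcv)`-equivariant bundle of complex d-vector
spaces over `B`, on which the isotropy d-group `(ℤ_k, ℤ_k)` acts with weight `q`, that is,
`(z, z')` acts by `z ^ q` on `hW` and by `z' ^ q` on `vW`. -/
structure IsPsiModule (eh : CentralExtension k E₃ Gch E₁ Gh) (ev : CentralExtension k E₄ Gcv E₂ Gv)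
    (P : PrincipalBundle IV IB (𝓘(ℝ, E₁).prod 𝓘(ℝ, E₂)) V B (Gh × Gv)) (q : ℤ)
    (W : EquivariantDFamily.{w} (liftedAction eh ev P)) : Prop where
  isBundle_h : W.h.IsBundle IB (𝓘(ℝ, E₃).prod 𝓘(ℝ, E₄))
  isBundle_v : W.v.IsBundle IB (𝓘(ℝ, E₃).prod 𝓘(ℝ, E₄))
  weight_h : ∀ (z z' : rootsOfUnity k ℂ) (b : B)
    (hb : b = liftedAction eh ev P (eh.incl z, ev.incl z') b) (e : W.h.Fiber b),
    W.h.act (eh.incl z, ev.incl z') b b hb e = ((z : ℂˣ) : ℂ) ^ q • e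
  weight_v : ∀ (z z' : rootsOfUnity k ℂ) (b : B)
    (hb : b = liftedAction eh ev P (eh.incl z, ev.incl z') b) (e : W.v.Fiber b),
    W.v.act (eh.incl z, ev.incl z') b b hb e = ((z' : ℂˣ) : ℂ) ^ q • e

/-- The pull-back of a bundle from `V` to `B`, with the tautological action
`E_{proj b} = E_{proj (g b)}`. -/
def pullbackComponent (eh : CentralExtension k E₃ Gch E₁ Gh) (ev : CentralExtension k E₄ Gcv E₂ Gv)
    (P : PrincipalBundle IV IB (𝓘(ℝ, E₁).prod 𝓘(ℝ, E₂)) V B (Gh × Gv))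
    (E : FramedFamily.{v, w} V) : EquivariantFamily.{w} (liftedAction eh ev P) where
  toFramedFamily := E.pullback P.proj
  act _ b b' h := E.castFiber (x := P.proj b) (y := P.proj b')
    (by rw [h]; exact (P.proj_act _ _).symm)

/-- The pull-back of a d-bundle from `V` to `B`. -/
def pullbackModule (eh : CentralExtension k E₃ Gch E₁ Gh) (ev : CentralExtension k E₄ Gcv E₂ Gv)
    (P : PrincipalBundle IV IB (𝓘(ℝ, E₁).prod 𝓘(ℝ, E₂)) V B (Gh × Gv))
    (E : DFamily.{v, w} V) : EquivariantDFamily.{w} (liftedAction eh ev P) :=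
  ⟨pullbackComponent eh ev P E.h, pullbackComponent eh ev P E.v⟩

/-- The pull-back of an N-adapted map of d-bundles from `V` to `B`. -/
def pullbackHom (eh : CentralExtension k E₃ Gch E₁ Gh) (ev : CentralExtension k E₄ Gcv E₂ Gv)
    (P : PrincipalBundle IV IB (𝓘(ℝ, E₁).prod 𝓘(ℝ, E₂)) V B (Gh × Gv))
    {E : DFamily.{v, w₁} V} {E' : DFamily.{v, w₂} V} (f : E.Hom E') :
    (pullbackModule eh ev P E).toDFamily.Hom (pullbackModule eh ev P E').toDFamily :=
  ⟨fun b => f.h (P.proj b), fun b => f.v (P.proj b)⟩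

end Modules

end NGerbe

end

/-! The heart of the matter is descent along `P.proj`. The structure group acts freely on `B`, so by
exactness of the two extensions the isotropy groups of the lifted action are exactly the copies of
`ℤ_k × ℤ_k`. In weight zero they act trivially on the fibres. Hence all group elements taking `b` to
`b'` induce the same map `W_b → W_{b'}`, and these canonical maps (`transport`) satisfy the cocycle
identity `transport_transport`.

They are also smooth. Two points of a fibre of `P.proj` differ by an element of the structure group
depending smoothly on them, and the coverings `eh.pr`, `ev.pr` have smooth local inverses, so the
element of the extended group can be chosen smoothly near any given pair
(`isQuotientAction_liftedAction`, `contMDiffAt_transport`). The descended bundle has fibre `W_{σ x}`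
for an arbitrary set-theoretic section `σ`; its frames are carried over from smooth local sections,
and `σ` cancels from every matrix entry by the cocycle identity.

For morphisms, equivariance under the tautological action means constancy along the fibres of
`P.proj`, and smoothness on `V` is read off along local sections (`exists_eq_pullback`). Thus
pull-back is fully faithful.

The operations are fibrewise linear algebra in dual frames. Weights multiply in a tensor product,
and conjugation by a scalar is trivial. -/

namespace NGerbe

/-! ## Dual frames -/

/-- `v` is a basis and `φ` is its dual basis. -/
structure IsDualFrame {κ F : Type*} [Fintype κ] [AddCommGroup F] [Module ℂ F] (v : κ → F)
    (φ : κ → F →ₗ[ℂ] ℂ) : Prop where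
  span : ∀ e, ∑ i, φ i e • v i = e
  dual : ∀ (a : κ → ℂ) (i : κ), φ i (∑ j, a j • v j) = a i

namespace IsDualFrame

variable {κ κ' F F' : Type*} [Fintype κ] [Fintype κ'] [AddCommGroup F] [Module ℂ F]
  [AddCommGroup F'] [Module ℂ F'] {v : κ → F} {φ : κ → F →ₗ[ℂ] ℂ} {v' : κ' → F'}
  {φ' : κ' → F' →ₗ[ℂ] ℂ}

theorem coord_vec [DecidableEq κ] (h : IsDualFrame v φ) (i j : κ) :
    φ i (v j) = if i = j then 1 else 0 := by
  simpa [Pi.single_apply] using h.dual (Pi.single j 1) i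

theorem of_coord_vec [DecidableEq κ] (hs : ∀ e, ∑ i, φ i e • v i = e)
    (h : ∀ i j, φ i (v j) = if i = j then 1 else 0) : IsDualFrame v φ :=
  ⟨hs, fun a i => by simp [h]⟩

theorem sum (h : IsDualFrame v φ) (h' : IsDualFrame v' φ') :
    IsDualFrame (κ := κ ⊕ κ') (F := F × F')
      (fun i => Sum.elim (fun i => (v i, 0)) (fun j => (0, v' j)) i)
      (fun i => Sum.elim (fun i => (φ i).comp (LinearMap.fst ℂ F F'))
        (fun j => (φ' j).comp (LinearMap.snd ℂ F F')) i) := by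
  classical
  refine of_coord_vec (fun e => ?_) fun i j => ?_
  · refine Prod.ext ?_ ?_
    · simp [Prod.fst_sum, h.span]
    · simp [Prod.snd_sum, h'.span]
  · rcases i with i | i <;> rcases j with j | j <;> simp [h.coord_vec, h'.coord_vec]

theorem tensor (h : IsDualFrame v φ) (h' : IsDualFrame v' φ') :
    IsDualFrame (κ := κ × κ') (F := F ⊗[ℂ] F') (fun i => v i.1 ⊗ₜ[ℂ] v' i.2)
      (fun i => (TensorProduct.lid ℂ ℂ).toLinearMap.comp
        (TensorProduct.map (φ i.1) (φ' i.2))) := by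
  classical
  refine of_coord_vec (fun e => ?_) fun i j => ?_
  · induction e using TensorProduct.induction_on with
    | zero => simp
    | add e₁ e₂ h₁ h₂ =>
      simp only [map_add, add_smul, Finset.sum_add_distrib, h₁, h₂]
    | tmul e e' =>
      conv_rhs => rw [← h.span e, ← h'.span e']
      simp only [TensorProduct.sum_tmul, TensorProduct.tmul_sum, TensorProduct.smul_tmul_smul]
      simp [Fintype.sum_prod_type_right]
  · by_cases h₁ : i.1 = j.1 <;> by_cases h₂ : i.2 = j.2 <;>
      simp [h.coord_vec, h'.coord_vec, Prod.ext_iff, h₁, h₂]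

theorem endo (h : IsDualFrame v φ) :
    IsDualFrame (κ := κ × κ) (F := F →ₗ[ℂ] F) (fun i => (φ i.2).smulRight (v i.1))
      (fun i => (φ i.1).comp (LinearMap.applyₗ (v i.2))) := by
  classical
  refine of_coord_vec (fun f => LinearMap.ext fun e => ?_) fun i j => ?_
  · conv_rhs => rw [← h.span e]
    -- The column index is summed outermost, so that each column `f (v j)` can be expanded in the
    -- frame separately.
    simp only [LinearMap.sum_apply, map_sum, map_smul, Fintype.sum_prod_type_right]
    refine Finset.sum_congr rfl fun j _ => ?_
    conv_rhs => rw [← h.span (f (v j)), Finset.smul_sum]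
    exact Finset.sum_congr rfl fun i _ => smul_comm _ _ _
  · rcases i with ⟨i, i'⟩
    rcases j with ⟨j, j'⟩
    by_cases h₁ : i = j <;> by_cases h₂ : i' = j' <;>
      simp [h.coord_vec, Prod.ext_iff, h₁, h₂, eq_comm]

end IsDualFrame

/-! ## Bundle constructions -/

namespace FramedFamily

section Framed

variable {EM HM : Type*} [NormedAddCommGroup EM] [NormedSpace ℝ EM] [TopologicalSpace HM]
  {I : ModelWithCorners ℝ EM HM} {M : Type v} [TopologicalSpace M] [ChartedSpace HM M]

/-- Matrix entries of tensor products and of conjugations are products of two entries; smoothness is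
over `ℝ`, where complex multiplication is a smooth bilinear map. -/
theorem contMDiffOn_mul_complex {f g : M → ℂ} {s : Set M} (hf : ContMDiffOn I 𝓘(ℝ, ℂ) ∞ f s)
    (hg : ContMDiffOn I 𝓘(ℝ, ℂ) ∞ g s) : ContMDiffOn I 𝓘(ℝ, ℂ) ∞ (fun x => f x * g x) s :=
  ((contDiff_mul (𝕜 := ℝ) (𝔸 := ℂ) (n := ∞)).contMDiff).comp_contMDiffOn (hf.prodMk_space hg)

theorem IsBundle.isDualFrame {E : FramedFamily.{v, w} M} (hE : E.IsBundle I)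
    {c : LocalFrame E.Fiber} (hc : c ∈ E.atlas) {x : M} (hx : x ∈ c.dom) :
    IsDualFrame (fun i => c.vec i x) (fun i => c.coord i x) :=
  ⟨hE.span c hc x hx, hE.dual c hc x hx⟩

theorem isBundle_sum {E : FramedFamily.{v, w₁} M} {E' : FramedFamily.{v, w₂} M}
    (hE : E.IsBundle I) (hE' : E'.IsBundle I) : (E.sum E').IsBundle I where
  isOpen_dom := by
    rintro _ ⟨c, hc, d, hd, rfl⟩
    exact (hE.isOpen_dom c hc).inter (hE'.isOpen_dom d hd)
  cover x := by
    obtain ⟨c, hc, hxc⟩ := hE.cover x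
    obtain ⟨d, hd, hxd⟩ := hE'.cover x
    exact ⟨_, ⟨c, hc, d, hd, rfl⟩, hxc, hxd⟩
  span := by
    rintro _ ⟨c, hc, d, hd, rfl⟩ x ⟨hxc, hxd⟩
    exact ((hE.isDualFrame hc hxc).sum (hE'.isDualFrame hd hxd)).span
  dual := by
    rintro _ ⟨c, hc, d, hd, rfl⟩ x ⟨hxc, hxd⟩
    exact ((hE.isDualFrame hc hxc).sum (hE'.isDualFrame hd hxd)).dual
  smooth_transition := by
    rintro _ ⟨c, hc, d, hd, rfl⟩ _ ⟨c', hc', d', hd', rfl⟩ i j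
    rcases i with i | i <;> rcases j with j | j
    · exact (hE.smooth_transition c hc c' hc' i j).mono fun x hx => ⟨hx.1.1, hx.2.1⟩
    · exact (contMDiffOn_const (c := (0 : ℂ))).congr fun x _ => map_zero (c'.coord i x)
    · exact (contMDiffOn_const (c := (0 : ℂ))).congr fun x _ => map_zero (d'.coord i x)
    · exact (hE'.smooth_transition d hd d' hd' i j).mono fun x hx => ⟨hx.1.2, hx.2.2⟩

theorem isBundle_tensor {E : FramedFamily.{v, w₁} M} {E' : FramedFamily.{v, w₂} M}
    (hE : E.IsBundle I) (hE' : E'.IsBundle I) : (E.tensor E').IsBundle I where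
  isOpen_dom := by
    rintro _ ⟨c, hc, d, hd, rfl⟩
    exact (hE.isOpen_dom c hc).inter (hE'.isOpen_dom d hd)
  cover x := by
    obtain ⟨c, hc, hxc⟩ := hE.cover x
    obtain ⟨d, hd, hxd⟩ := hE'.cover x
    exact ⟨_, ⟨c, hc, d, hd, rfl⟩, hxc, hxd⟩
  span := by
    rintro _ ⟨c, hc, d, hd, rfl⟩ x ⟨hxc, hxd⟩
    exact ((hE.isDualFrame hc hxc).tensor (hE'.isDualFrame hd hxd)).span
  dual := by
    rintro _ ⟨c, hc, d, hd, rfl⟩ x ⟨hxc, hxd⟩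
    exact ((hE.isDualFrame hc hxc).tensor (hE'.isDualFrame hd hxd)).dual
  smooth_transition := by
    rintro _ ⟨c, hc, d, hd, rfl⟩ _ ⟨c', hc', d', hd', rfl⟩ i j
    exact contMDiffOn_mul_complex
      ((hE.smooth_transition c hc c' hc' i.1 j.1).mono fun x hx => ⟨hx.1.1, hx.2.1⟩)
      ((hE'.smooth_transition d hd d' hd' i.2 j.2).mono fun x hx => ⟨hx.1.2, hx.2.2⟩)

theorem isBundle_endo {E : FramedFamily.{v, w} M} (hE : E.IsBundle I) : E.endo.IsBundle I where
  isOpen_dom := by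
    rintro _ ⟨c, hc, rfl⟩
    exact hE.isOpen_dom c hc
  cover x := by
    obtain ⟨c, hc, hxc⟩ := hE.cover x
    exact ⟨_, ⟨c, hc, rfl⟩, hxc⟩
  span := by
    rintro _ ⟨c, hc, rfl⟩ x hx
    exact (hE.isDualFrame hc hx).endo.span
  dual := by
    rintro _ ⟨c, hc, rfl⟩ x hx
    exact (hE.isDualFrame hc hx).endo.dual
  smooth_transition := by
    rintro _ ⟨c, hc, rfl⟩ _ ⟨d, hd, rfl⟩ i j
    -- An elementary matrix of `c`, read in the frame `d`, has entries which are a transition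
    -- function from `d` to `c` times one from `c` to `d`.
    exact (contMDiffOn_mul_complex
      ((hE.smooth_transition d hd c hc j.2 i.2).mono fun x hx => ⟨hx.2, hx.1⟩)
      (hE.smooth_transition c hc d hd i.1 j.1)).congr fun x _ => map_smul (d.coord i.1 x) _ _

end Framed

/-! ### Pull-back of bundles and of smooth morphisms -/

section Pullback

variable {EM HM : Type*} [NormedAddCommGroup EM] [NormedSpace ℝ EM] [TopologicalSpace HM]
  {I : ModelWithCorners ℝ EM HM} {M : Type v} [TopologicalSpace M] [ChartedSpace HM M]
  {EB HB : Type*} [NormedAddCommGroup EB] [NormedSpace ℝ EB] [TopologicalSpace HB]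
  {IB : ModelWithCorners ℝ EB HB} {B : Type u} [TopologicalSpace B] [ChartedSpace HB B]
  {p : B → M}

theorem isBundle_pullback (hp : ContMDiff IB I ∞ p) {E : FramedFamily.{v, w} M}
    (hE : E.IsBundle I) : (E.pullback p).IsBundle IB where
  isOpen_dom := by
    rintro _ ⟨c, hc, rfl⟩
    exact (hE.isOpen_dom c hc).preimage hp.continuous
  cover x := by
    obtain ⟨c, hc, hxc⟩ := hE.cover (p x)
    exact ⟨_, ⟨c, hc, rfl⟩, hxc⟩
  span := by
    rintro _ ⟨c, hc, rfl⟩ x hx e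
    exact hE.span c hc (p x) hx e
  dual := by
    rintro _ ⟨c, hc, rfl⟩ x hx a i
    exact hE.dual c hc (p x) hx a i
  smooth_transition := by
    rintro _ ⟨c, hc, rfl⟩ _ ⟨d, hd, rfl⟩ i j
    exact (hE.smooth_transition c hc d hd i j).comp hp.contMDiffOn fun x hx => hx

theorem IsSmoothHom.pullback (hp : ContMDiff IB I ∞ p) {E : FramedFamily.{v, w₁} M}
    {E' : FramedFamily.{v, w₂} M} {f : ∀ x, E.Fiber x →ₗ[ℂ] E'.Fiber x}
    (hf : E.IsSmoothHom I E' f) :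
    (E.pullback p).IsSmoothHom IB (E'.pullback p) fun b => f (p b) := by
  rintro _ ⟨c, hc, rfl⟩ _ ⟨d, hd, rfl⟩ i j
  exact (hf c hc d hd i j).comp hp.contMDiffOn fun x hx => hx

end Pullback

/-! ### Fibres over equal base points -/

section CastFiber

variable {M : Type v}

@[simp]
theorem castFiber_rfl (E : FramedFamily.{v, w} M) {x : M} (h : x = x) (e : E.Fiber x) :
    E.castFiber h e = e := rfl

theorem apply_castFiber (E : FramedFamily.{v, w₁} M) (E' : FramedFamily.{v, w₂} M)
    (f : ∀ x, E.Fiber x →ₗ[ℂ] E'.Fiber x) {x y : M} (h : x = y) (e : E.Fiber x) :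
    f y (E.castFiber h e) = E'.castFiber h (f x e) := by
  subst h; rfl

theorem castFiber_castFiber (E : FramedFamily.{v, w} M) {x y z : M} (h : x = y) (h' : y = z)
    (e : E.Fiber x) : E.castFiber h' (E.castFiber h e) = E.castFiber (h.trans h') e := by
  subst h h'; rfl

theorem coord_castFiber_vec (E : FramedFamily.{v, w} M) (c d : LocalFrame E.Fiber) (i : d.κ)
    (j : c.κ) {x y : M} (h : x = y) :
    d.coord i y (E.castFiber h (c.vec j x)) = d.coord i x (c.vec j x) := by
  subst h; rfl

end CastFiber

end FramedFamily

/-! ## Equivariant constructions -/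

namespace EquivariantFamily

section Equivariant

variable {EB HB : Type*} [NormedAddCommGroup EB] [NormedSpace ℝ EB] [TopologicalSpace HB]
  {IB : ModelWithCorners ℝ EB HB} {B : Type v} [TopologicalSpace B] [ChartedSpace HB B]
  {EΓ HΓ : Type*} [NormedAddCommGroup EΓ] [NormedSpace ℝ EΓ] [TopologicalSpace HΓ]
  {IΓ : ModelWithCorners ℝ EΓ HΓ} {Γ : Type u} [TopologicalSpace Γ] [ChartedSpace HΓ Γ] [Group Γ]
  {a : Γ → B → B}

theorem isBundle_sum {W : EquivariantFamily.{w₁} a} {W' : EquivariantFamily.{w₂} a}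
    (hW : W.IsBundle IB IΓ) (hW' : W'.IsBundle IB IΓ) : (W.sum W').IsBundle IB IΓ where
  isBundle := FramedFamily.isBundle_sum hW.isBundle hW'.isBundle
  act_one b h e := Prod.ext (hW.act_one b h e.1) (hW'.act_one b h e.2)
  act_mul g g' b b' b'' h' h h'' e :=
    Prod.ext (hW.act_mul g g' b b' b'' h' h h'' e.1) (hW'.act_mul g g' b b' b'' h' h h'' e.2)
  smooth_act := by
    rintro _ ⟨c, hc, d, hd, rfl⟩ _ ⟨c', hc', d', hd', rfl⟩ i j
    rcases i with i | i <;> rcases j with j | j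
    · exact (hW.smooth_act c hc c' hc' i j).mono fun x hx => ⟨hx.1.1, hx.2.1⟩
    · exact (contMDiffOn_const (c := (0 : ℂ))).congr fun x _ => by
        change c'.coord i _ (W.act x.1 x.2 _ rfl 0) = 0
        rw [map_zero, map_zero]
    · exact (contMDiffOn_const (c := (0 : ℂ))).congr fun x _ => by
        change d'.coord i _ (W'.act x.1 x.2 _ rfl 0) = 0
        rw [map_zero, map_zero]
    · exact (hW'.smooth_act d hd d' hd' i j).mono fun x hx => ⟨hx.1.2, hx.2.2⟩

theorem isBundle_tensor {W : EquivariantFamily.{w₁} a} {W' : EquivariantFamily.{w₂} a}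
    (hW : W.IsBundle IB IΓ) (hW' : W'.IsBundle IB IΓ) : (W.tensor W').IsBundle IB IΓ where
  isBundle := FramedFamily.isBundle_tensor hW.isBundle hW'.isBundle
  act_one b h := LinearMap.congr_fun (f := (TensorProduct.congr (W.act 1 b b h)
    (W'.act 1 b b h)).toLinearMap) (g := LinearMap.id) <| TensorProduct.ext' fun e e' =>
      congrArg₂ (· ⊗ₜ[ℂ] ·) (hW.act_one b h e) (hW'.act_one b h e')
  act_mul g g' b b' b'' h' h h'' := LinearMap.congr_fun
    (f := (TensorProduct.congr (W.act (g * g') b b'' h'') (W'.act (g * g') b b'' h'')).toLinearMap)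
    (g := (TensorProduct.congr (W.act g b' b'' h) (W'.act g b' b'' h)).toLinearMap.comp
      (TensorProduct.congr (W.act g' b b' h') (W'.act g' b b' h')).toLinearMap) <|
    TensorProduct.ext' fun e e' => congrArg₂ (· ⊗ₜ[ℂ] ·)
      (hW.act_mul g g' b b' b'' h' h h'' e) (hW'.act_mul g g' b b' b'' h' h h'' e')
  smooth_act := by
    rintro _ ⟨c, hc, d, hd, rfl⟩ _ ⟨c', hc', d', hd', rfl⟩ i j
    exact FramedFamily.contMDiffOn_mul_complex
      ((hW.smooth_act c hc c' hc' i.1 j.1).mono fun x hx => ⟨hx.1.1, hx.2.1⟩)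
      ((hW'.smooth_act d hd d' hd' i.2 j.2).mono fun x hx => ⟨hx.1.2, hx.2.2⟩)

/-- Since `a` is an arbitrary map here, the instances of the action laws that are needed enter as
the equalities `h'` and `h₁`. -/
theorem IsBundle.act_inv_act {W : EquivariantFamily.{w} a} (hW : W.IsBundle IB IΓ) {g : Γ}
    {b b' : B} (h : b' = a g b) (h' : b = a g⁻¹ b') (h₁ : b = a 1 b) (e : W.Fiber b) :
    W.act g⁻¹ b' b h' (W.act g b b' h e) = e := by
  have h₂ : b = a (g⁻¹ * g) b := by simpa using h₁
  rw [← hW.act_mul g⁻¹ g b b' b h h' h₂]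
  simp only [inv_mul_cancel]
  exact hW.act_one b h₁ e

theorem IsBundle.act_symm {W : EquivariantFamily.{w} a} (hW : W.IsBundle IB IΓ) {g : Γ}
    {b b' : B} (h : b' = a g b) (h' : b = a g⁻¹ b') (h₁ : b = a 1 b) (e : W.Fiber b') :
    (W.act g b b' h).symm e = W.act g⁻¹ b' b h' e := by
  obtain ⟨e, rfl⟩ := (W.act g b b' h).surjective e
  rw [LinearEquiv.symm_apply_apply, hW.act_inv_act h h' h₁]

theorem isBundle_endo [LieGroup IΓ ∞ Γ]
    (ha : ContMDiff (IΓ.prod IB) IB ∞ fun p : Γ × B => a p.1 p.2)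
    (a_one : ∀ b, a 1 b = b) (a_mul : ∀ g g' b, a (g * g') b = a g (a g' b))
    {W : EquivariantFamily.{w} a}
    (hW : W.IsBundle IB IΓ) : W.endo.IsBundle IB IΓ where
  isBundle := FramedFamily.isBundle_endo hW.isBundle
  act_one b h (f : W.Fiber b →ₗ[ℂ] W.Fiber b) := by
    have h₁ : W.act 1 b b h = LinearEquiv.refl ℂ _ := LinearEquiv.ext (hW.act_one b h)
    change (W.act 1 b b h).conj f = f
    rw [h₁]
    rfl
  act_mul g g' b b' b'' h' h h'' (f : W.Fiber b →ₗ[ℂ] W.Fiber b) := by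
    have h₁ : W.act (g * g') b b'' h'' = (W.act g' b b' h').trans (W.act g b' b'' h) :=
      LinearEquiv.ext (hW.act_mul g g' b b' b'' h' h h'')
    change (W.act (g * g') b b'' h'').conj f = (W.act g b' b'' h).conj ((W.act g' b b' h').conj f)
    rw [h₁]
    rfl
  smooth_act := by
    rintro _ ⟨c, hc, rfl⟩ _ ⟨d, hd, rfl⟩ i j
    -- The points `g⁻¹ (g b)` and `b` are only propositionally equal; with the endpoint a free
    -- variable, `subst` identifies the fibres.
    have key : ∀ (g : Γ) (b b' b'' : B) (h : b'' = b) (h' : b = a g b') (h'' : b'' = a g b'),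
        c.coord j.2 b (W.act g b' b h' (d.vec i.2 b'))
          = c.coord j.2 b'' (W.act g b' b'' h'' (d.vec i.2 b')) := by
      intro g b b' b'' h h' h''
      subst h
      rfl
    have hinv : ∀ g b, a g⁻¹ (a g b) = b := fun g b => by rw [← a_mul, inv_mul_cancel, a_one]
    -- Conjugation involves `g⁻¹ : W_{gb} → W_b`, whose entries are those of the action evaluated at
    -- `(g⁻¹, g b)`.
    have hψ : ContMDiff (IΓ.prod IB) (IΓ.prod IB) ∞ fun p : Γ × B => (p.1⁻¹, a p.1 p.2) :=
      (contMDiff_inv IΓ ∞).comp contMDiff_fst |>.prodMk ha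
    refine (FramedFamily.contMDiffOn_mul_complex
      ((hW.smooth_act d hd c hc j.2 i.2).comp hψ.contMDiffOn
        fun p hp => ⟨hp.2, by simpa [hinv] using hp.1⟩)
      (hW.smooth_act c hc d hd i.1 j.1)).congr fun p _ => ?_
    have h₁ := hW.act_symm (g := p.1) (b := p.2) rfl (hinv _ _).symm (a_one _).symm
      (d.vec i.2 (a p.1 p.2))
    change d.coord i.1 _ (W.act p.1 p.2 _ rfl (c.coord j.2 p.2
      ((W.act p.1 p.2 _ rfl).symm (d.vec i.2 (a p.1 p.2))) • c.vec j.1 p.2)) = _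
    rw [map_smul, map_smul, h₁, key _ _ _ _ (hinv _ _) _ rfl]
    rfl

end Equivariant

end EquivariantFamily

/-! ## Descent -/

open Filter Topology

section Descent

variable {EV HV : Type*} [NormedAddCommGroup EV] [NormedSpace ℝ EV] [TopologicalSpace HV]
  {IV : ModelWithCorners ℝ EV HV} {V : Type v} [TopologicalSpace V] [ChartedSpace HV V]
  {EB HB : Type*} [NormedAddCommGroup EB] [NormedSpace ℝ EB] [TopologicalSpace HB]
  {IB : ModelWithCorners ℝ EB HB} {B : Type u} [TopologicalSpace B] [ChartedSpace HB B]
  {EΓ HΓ : Type*} [NormedAddCommGroup EΓ] [NormedSpace ℝ EΓ] [TopologicalSpace HΓ]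
  {IΓ : ModelWithCorners ℝ EΓ HΓ} {Γ : Type*} [TopologicalSpace Γ] [ChartedSpace HΓ Γ] [Group Γ]

/-- A smooth action `a` of `Γ` on `B` whose orbits are the fibres of `p : B → V`, where `p` has
smooth local sections and points of the same fibre are related by elements of `Γ` which can be
chosen to depend smoothly on them, locally. -/
structure IsQuotientAction (IV : ModelWithCorners ℝ EV HV) (IB : ModelWithCorners ℝ EB HB)
    (IΓ : ModelWithCorners ℝ EΓ HΓ) (p : B → V) (a : Γ → B → B) : Prop where
  one : ∀ b, a 1 b = b
  mul : ∀ g g' b, a (g * g') b = a g (a g' b)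
  proj_act : ∀ g b, p (a g b) = p b
  smooth_proj : ContMDiff IB IV ∞ p
  smooth_act : ContMDiff (IΓ.prod IB) IB ∞ fun q : Γ × B => a q.1 q.2
  local_section : ∀ x : V, ∃ (U : Set V) (s : V → B), IsOpen U ∧ x ∈ U ∧
    ContMDiffOn IV IB ∞ s U ∧ ∀ y ∈ U, p (s y) = y
  local_lift : ∀ b b' : B, p b = p b' → ∃ γ : B × B → Γ,
    ContMDiffAt (IB.prod IB) IΓ ∞ γ (b, b') ∧
    ∀ᶠ q in 𝓝 (b, b'), p q.1 = p q.2 → a (γ q) q.1 = q.2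

namespace IsQuotientAction

variable {p : B → V} {a : Γ → B → B}

theorem exists_act_eq (ha : IsQuotientAction IV IB IΓ p a) {b b' : B} (h : p b = p b') :
    ∃ g, b' = a g b := by
  obtain ⟨γ, -, hγ⟩ := ha.local_lift b b' h
  exact ⟨_, (hγ.self_of_nhds h).symm⟩

theorem surjective (ha : IsQuotientAction IV IB IΓ p a) : Function.Surjective p := fun x =>
  let ⟨_, s, _, hx, _, h⟩ := ha.local_section x
  ⟨s x, h x hx⟩

end IsQuotientAction

/-! ### Canonical transport along the orbits and the descended bundle -/

namespace EquivariantFamily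

variable {p : B → V} {a : Γ → B → B}

open Classical in
/-- The transport `W_b → W_{b'}` by some element that takes `b` to `b'` (zero if there is none). -/
noncomputable def transport (W : EquivariantFamily.{w} a) (b b' : B) : W.Fiber b →ₗ[ℂ] W.Fiber b' :=
  if h : ∃ g, b' = a g b then (W.act h.choose b b' h.choose_spec).toLinearMap else 0

/-- The isotropy groups act trivially on the fibres. -/
def TrivialIsotropy (W : EquivariantFamily.{w} a) : Prop :=
  ∀ (g : Γ) (b : B) (h : b = a g b) (e : W.Fiber b), W.act g b b h e = e

variable {W : EquivariantFamily.{w} a}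

/-- If `g` and `g'` both take `b` to `b'`, then `g⁻¹ * g'` fixes `b` and acts trivially on its
fibre, so `g' = g * (g⁻¹ * g')` acts there as `g` does. The choice inside `transport` is therefore
immaterial. -/
theorem transport_eq (ha : IsQuotientAction IV IB IΓ p a) (hW : W.IsBundle IB IΓ)
    (h₀ : W.TrivialIsotropy) {g : Γ} {b b' : B} (h : b' = a g b) (e : W.Fiber b) :
    W.transport b b' e = W.act g b b' h e := by
  have h₁ : ∃ g, b' = a g b := ⟨g, h⟩
  obtain ⟨g', hg', hT⟩ : ∃ (g' : Γ) (hg' : b' = a g' b),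
      W.transport b b' e = W.act g' b b' hg' e :=
    ⟨h₁.choose, h₁.choose_spec, by rw [transport, dif_pos h₁]; rfl⟩
  rw [hT]
  have h₂ : b = a (g⁻¹ * g') b := by rw [ha.mul, ← hg', h, ← ha.mul, inv_mul_cancel, ha.one]
  have h₃ : b' = a (g * (g⁻¹ * g')) b := by simpa using hg'
  have h₄ := hW.act_mul g (g⁻¹ * g') b b b' h₂ h h₃ e
  rw [h₀] at h₄
  rw [← h₄]
  simp only [mul_inv_cancel_left]

theorem transport_self (ha : IsQuotientAction IV IB IΓ p a) (hW : W.IsBundle IB IΓ)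
    (h₀ : W.TrivialIsotropy) (b : B) (e : W.Fiber b) : W.transport b b e = e := by
  rw [transport_eq ha hW h₀ (ha.one b).symm, hW.act_one]

theorem transport_transport (ha : IsQuotientAction IV IB IΓ p a) (hW : W.IsBundle IB IΓ)
    (h₀ : W.TrivialIsotropy) {b b' b'' : B} (h : p b = p b') (h' : p b' = p b'') (e : W.Fiber b) :
    W.transport b' b'' (W.transport b b' e) = W.transport b b'' e := by
  obtain ⟨g, hg⟩ := ha.exists_act_eq h
  obtain ⟨g', hg'⟩ := ha.exists_act_eq h'
  have h₁ : b'' = a (g' * g) b := by rw [ha.mul, ← hg, ← hg']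
  rw [transport_eq ha hW h₀ hg, transport_eq ha hW h₀ hg', transport_eq ha hW h₀ h₁,
    hW.act_mul g' g b b' b'' hg hg' h₁]

theorem transport_act (ha : IsQuotientAction IV IB IΓ p a) (hW : W.IsBundle IB IΓ)
    (h₀ : W.TrivialIsotropy) {g : Γ} {b b' b'' : B} (hg : b' = a g b) (h : p b = p b'')
    (e : W.Fiber b) : W.transport b' b'' (W.act g b b' hg e) = W.transport b b'' e := by
  have h₁ : p b = p b' := by rw [hg, ha.proj_act]
  rw [← transport_eq ha hW h₀ hg, transport_transport ha hW h₀ h₁ (h₁.symm.trans h)]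

section Smooth

variable {EM HM : Type*} [NormedAddCommGroup EM] [NormedSpace ℝ EM] [TopologicalSpace HM]
  {I : ModelWithCorners ℝ EM HM} {M : Type*} [TopologicalSpace M] [ChartedSpace HM M]

/-- Near `y` the connecting element can be taken as `γ (β x, β' x)`, smooth in `x`, which turns the
entries of the transport into those of the smooth action. The smoothness claims about the descended
bundle and its comparison maps reduce to this, with `β`, `β'` among local sections `s`, the identity
and `s ∘ p`. -/
theorem contMDiffAt_transport (ha : IsQuotientAction IV IB IΓ p a) (hW : W.IsBundle IB IΓ)
    (h₀ : W.TrivialIsotropy) {c d : LocalFrame W.Fiber} (hc : c ∈ W.atlas) (hd : d ∈ W.atlas)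
    (i : d.κ) (j : c.κ) {β β' : M → B} {y : M} (hβ : ContMDiffAt I IB ∞ β y)
    (hβ' : ContMDiffAt I IB ∞ β' y) (hp : ∀ᶠ x in 𝓝 y, p (β x) = p (β' x))
    (hyc : β y ∈ c.dom) (hyd : β' y ∈ d.dom) :
    ContMDiffAt I 𝓘(ℝ, ℂ) ∞
      (fun x => d.coord i (β' x) (W.transport (β x) (β' x) (c.vec j (β x)))) y := by
  obtain ⟨γ, hγ, hγ'⟩ := ha.local_lift (β y) (β' y) hp.self_of_nhds
  have hββ' : ContMDiffAt I (IB.prod IB) ∞ (fun x => (β x, β' x)) y := hβ.prodMk hβ'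
  have hγβ : ContMDiffAt I IΓ ∞ (fun x => γ (β x, β' x)) y :=
    ContMDiffAt.comp (g := γ) y hγ hββ'
  have hev := hββ'.continuousAt.eventually hγ'
  have hS : IsOpen {q : Γ × B | q.2 ∈ c.dom ∧ a q.1 q.2 ∈ d.dom} :=
    ((hW.isBundle.isOpen_dom c hc).preimage continuous_snd).inter
      ((hW.isBundle.isOpen_dom d hd).preimage ha.smooth_act.continuous)
  have hy : a (γ (β y, β' y)) (β y) = β' y := hγ'.self_of_nhds hp.self_of_nhds
  have hact := (hW.smooth_act c hc d hd i j).contMDiffAt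
    (x := (γ (β y, β' y), β y)) (hS.mem_nhds ⟨hyc, by simpa [hy] using hyd⟩)
  refine (ContMDiffAt.comp (f := fun x => (γ (β x, β' x), β x)) y hact
    (hγβ.prodMk hβ)).congr_of_eventuallyEq ?_
  filter_upwards [hp, hev] with x hx hx'
  -- With `b'` a free variable the equality of endpoints can be eliminated, although the fibre types
  -- depend on it.
  have key : ∀ (g : Γ) (b b' : B) (h : a g b = b'),
      d.coord i b' (W.transport b b' (c.vec j b))
        = d.coord i (a g b) (W.act g b _ rfl (c.vec j b)) := by
    rintro g b _ rfl
    rw [transport_eq ha hW h₀ rfl]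
  exact key _ _ _ (hx' hx)

end Smooth

/-- The bundle over the quotient defined by a bundle with trivial action of the isotropy groups.
Its fibre over `x` is the fibre over the chosen point `σ x`. -/
noncomputable def descend (IV : ModelWithCorners ℝ EV HV) (IB : ModelWithCorners ℝ EB HB) (p : B → V)
    (σ : V → B) (W : EquivariantFamily.{w} a) : FramedFamily.{v, w} V where
  Fiber x := W.Fiber (σ x)
  atlas := { q | ∃ c ∈ W.atlas, ∃ (U : Set V) (s : V → B), IsOpen U ∧ ContMDiffOn IV IB ∞ s U ∧
    (∀ y ∈ U, p (s y) = y) ∧ q =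
    { κ := c.κ
      dom := U ∩ s ⁻¹' c.dom
      vec := fun i x => W.transport (s x) (σ x) (c.vec i (s x))
      coord := fun i x => (c.coord i (s x)).comp (W.transport (σ x) (s x)) } }

variable {σ : V → B}

/-- No continuity of `σ` is required: frames come from local sections `s`, and going `s x → σ x → s'
x` is the same as going `s x → s' x` directly. -/
theorem isBundle_descend (ha : IsQuotientAction IV IB IΓ p a) (hW : W.IsBundle IB IΓ)
    (h₀ : W.TrivialIsotropy) (hσ : ∀ x, p (σ x) = x) : (W.descend IV IB p σ).IsBundle IV where
  isOpen_dom := by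
    rintro _ ⟨c, hc, U, s, hU, hs, hps, rfl⟩
    exact hs.continuousOn.isOpen_inter_preimage hU (hW.isBundle.isOpen_dom c hc)
  cover x := by
    obtain ⟨U, s, hU, hx, hs, hps⟩ := ha.local_section x
    obtain ⟨c, hc, hxc⟩ := hW.isBundle.cover (s x)
    exact ⟨_, ⟨c, hc, U, s, hU, hs, hps, rfl⟩, hx, hxc⟩
  span := by
    rintro _ ⟨c, hc, U, s, hU, hs, hps, rfl⟩ x ⟨hxU, hx⟩ (e : W.Fiber (σ x))
    have h₁ : p (s x) = p (σ x) := (hps x hxU).trans (hσ x).symm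
    have h₂ := congrArg (W.transport (s x) (σ x))
      (hW.isBundle.span c hc (s x) hx (W.transport (σ x) (s x) e))
    rw [transport_transport ha hW h₀ h₁.symm h₁, transport_self ha hW h₀, map_sum] at h₂
    simp only [map_smul] at h₂
    exact h₂
  dual := by
    rintro _ ⟨c, hc, U, s, hU, hs, hps, rfl⟩ x ⟨hxU, hx⟩ t i
    have h₁ : p (s x) = p (σ x) := (hps x hxU).trans (hσ x).symm
    change c.coord i (s x) (W.transport (σ x) (s x)
      (∑ j, t j • W.transport (s x) (σ x) (c.vec j (s x)))) = t i
    simp only [map_sum, map_smul, transport_transport ha hW h₀ h₁ h₁.symm,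
      transport_self ha hW h₀]
    have h₂ := hW.isBundle.dual c hc (s x) hx t i
    simpa only [map_sum, map_smul] using h₂
  smooth_transition := by
    rintro _ ⟨c, hc, U, s, hU, hs, hps, rfl⟩ _ ⟨c', hc', U', s', hU', hs', hps', rfl⟩ i j
    rintro x ⟨⟨hxU, hx⟩, hxU', hx'⟩
    refine ContMDiffAt.contMDiffWithinAt ?_
    have hp : ∀ᶠ y in 𝓝 x, p (s y) = y ∧ p (s' y) = y := by
      filter_upwards [hU.mem_nhds hxU, hU'.mem_nhds hxU'] with y hy hy'
      exact ⟨hps y hy, hps' y hy'⟩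
    refine (contMDiffAt_transport ha hW h₀ hc hc' i j (hs.contMDiffAt (hU.mem_nhds hxU))
      (hs'.contMDiffAt (hU'.mem_nhds hxU')) (hp.mono fun y hy => hy.1.trans hy.2.symm)
      hx hx').congr_of_eventuallyEq ?_
    filter_upwards [hp] with y hy
    exact congrArg (c'.coord i (s' y)) (transport_transport ha hW h₀ (hy.1.trans (hσ y).symm)
      ((hσ y).trans hy.2.symm) _)

/-- In a frame built from a local section `s` the map becomes the transport from `b` to `s (p b)`,
both of which vary smoothly with `b`. -/
theorem isSmoothHom_to_descend (ha : IsQuotientAction IV IB IΓ p a) (hW : W.IsBundle IB IΓ)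
    (h₀ : W.TrivialIsotropy) (hσ : ∀ x, p (σ x) = x) :
    W.toFramedFamily.IsSmoothHom IB ((W.descend IV IB p σ).pullback p)
      fun b => W.transport b (σ (p b)) := by
  rintro c hc _ ⟨_, ⟨d, hd, U, s, hU, hs, hps, rfl⟩, rfl⟩ i j b ⟨hbc, hbU, hbd⟩
  refine ContMDiffAt.contMDiffWithinAt ?_
  have hsb : ContMDiffAt IB IB ∞ (fun b => s (p b)) b :=
    ContMDiffAt.comp (g := s) b (hs.contMDiffAt (hU.mem_nhds hbU)) ha.smooth_proj.contMDiffAt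
  have hp : ∀ᶠ b' in 𝓝 b, p (s (p b')) = p b' := by
    filter_upwards [ha.smooth_proj.continuous.continuousAt.preimage_mem_nhds (hU.mem_nhds hbU)]
      with b' hb' using hps _ hb'
  refine (contMDiffAt_transport ha hW h₀ hc hd i j contMDiffAt_id hsb
    (hp.mono fun _ h => h.symm) hbc hbd).congr_of_eventuallyEq ?_
  filter_upwards [hp] with b' hb'
  exact congrArg (d.coord i _) (transport_transport ha hW h₀ (hσ _).symm
    ((hσ _).trans hb'.symm) _)

theorem isSmoothHom_of_descend (ha : IsQuotientAction IV IB IΓ p a) (hW : W.IsBundle IB IΓ)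
    (h₀ : W.TrivialIsotropy) (hσ : ∀ x, p (σ x) = x) :
    ((W.descend IV IB p σ).pullback p).IsSmoothHom IB W.toFramedFamily
      fun b => W.transport (σ (p b)) b := by
  rintro _ ⟨_, ⟨d, hd, U, s, hU, hs, hps, rfl⟩, rfl⟩ c hc i j b ⟨⟨hbU, hbd⟩, hbc⟩
  refine ContMDiffAt.contMDiffWithinAt ?_
  have hsb : ContMDiffAt IB IB ∞ (fun b => s (p b)) b :=
    ContMDiffAt.comp (g := s) b (hs.contMDiffAt (hU.mem_nhds hbU)) ha.smooth_proj.contMDiffAt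
  have hp : ∀ᶠ b' in 𝓝 b, p (s (p b')) = p b' := by
    filter_upwards [ha.smooth_proj.continuous.continuousAt.preimage_mem_nhds (hU.mem_nhds hbU)]
      with b' hb' using hps _ hb'
  refine (contMDiffAt_transport ha hW h₀ hd hc i j hsb contMDiffAt_id hp hbd
    hbc).congr_of_eventuallyEq ?_
  filter_upwards [hp] with b' hb'
  exact congrArg (c.coord i _) (transport_transport ha hW h₀ (hb'.trans (hσ _).symm) (hσ _) _)

/-- This expresses the tautological action on the pull-back of the descended bundle through
`transport`, so that equivariance follows from the cocycle identity. -/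
theorem castFiber_descend (ha : IsQuotientAction IV IB IΓ p a) (hW : W.IsBundle IB IΓ)
    (h₀ : W.TrivialIsotropy) {x y : V} (h : x = y) (e : W.Fiber (σ x)) :
    (W.descend IV IB p σ).castFiber h e = W.transport (σ x) (σ y) e := by
  subst h
  exact (transport_self ha hW h₀ _ e).symm

end EquivariantFamily

/-! ### Equivariant pull-backs and descent of morphisms -/

namespace FramedFamily

variable {p : B → V} {a : Γ → B → B}

/-- The pull-back of a bundle along an invariant map, with the tautological action. -/
def equivariantPullback (hp : ∀ g b, p (a g b) = p b) (E : FramedFamily.{v, w} V) :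
    EquivariantFamily.{w} a where
  toFramedFamily := E.pullback p
  act _ b b' h := E.castFiber (x := p b) (y := p b') (by rw [h, hp])

theorem isBundle_equivariantPullback (ha : IsQuotientAction IV IB IΓ p a) {E : FramedFamily.{v, w} V}
    (hE : E.IsBundle IV) : (E.equivariantPullback ha.proj_act).IsBundle IB IΓ where
  isBundle := isBundle_pullback ha.smooth_proj hE
  act_one _ _ _ := rfl
  act_mul _ _ _ _ _ _ _ _ e := (E.castFiber_castFiber _ _ e).symm
  smooth_act := by
    rintro _ ⟨c, hc, rfl⟩ _ ⟨d, hd, rfl⟩ i j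
    have hp : ContMDiff (IΓ.prod IB) IV ∞ fun q : Γ × B => p q.2 :=
      ha.smooth_proj.comp contMDiff_snd
    -- The tautological action does not see the group element: its entries are the transition
    -- functions at `p q.2`.
    refine ((hE.smooth_transition c hc d hd i j).comp hp.contMDiffOn fun q hq => ⟨hq.1, ?_⟩).congr
      fun q _ => E.coord_castFiber_vec c d i j (ha.proj_act q.1 q.2).symm
    have h₁ : p (a q.1 q.2) ∈ d.dom := hq.2
    rwa [ha.proj_act] at h₁

theorem isEquivariantHom_pullback (ha : IsQuotientAction IV IB IΓ p a)
    {E : FramedFamily.{v, w₁} V} {E' : FramedFamily.{v, w₂} V}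
    {f : ∀ x, E.Fiber x →ₗ[ℂ] E'.Fiber x} (hf : E.IsSmoothHom IV E' f) :
    (E.equivariantPullback ha.proj_act).IsEquivariantHom IB (E'.equivariantPullback ha.proj_act)
      fun b => f (p b) :=
  ⟨hf.pullback ha.smooth_proj, fun _ _ _ _ e => E.apply_castFiber E' f _ e⟩

/-- Orbits are whole fibres of `p`, so an equivariant `F` takes the same value, up to `castFiber`,
at all points over `x`; that value, computed at `σ x`, defines `f x`. -/
theorem exists_eq_pullback (ha : IsQuotientAction IV IB IΓ p a)
    {E : FramedFamily.{v, w₁} V} {E' : FramedFamily.{v, w₂} V}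
    (hE : E.IsBundle IV) (hE' : E'.IsBundle IV)
    {F : ∀ b, E.Fiber (p b) →ₗ[ℂ] E'.Fiber (p b)}
    (hF : (E.equivariantPullback ha.proj_act).IsEquivariantHom IB
      (E'.equivariantPullback ha.proj_act) F) :
    ∃ f : ∀ x, E.Fiber x →ₗ[ℂ] E'.Fiber x, E.IsSmoothHom IV E' f ∧ ∀ b, f (p b) = F b := by
  choose σ hσ using ha.surjective
  have hcast : ∀ {b b' : B} (h : p b = p b') (e : E.Fiber (p b)),
      F b' (E.castFiber h e) = E'.castFiber h (F b e) := by
    intro b b' h e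
    obtain ⟨g, hg⟩ := ha.exists_act_eq h
    exact hF.2 g b b' hg e
  have hfF : ∀ b, (E'.castFiber (hσ (p b))).toLinearMap.comp ((F (σ (p b))).comp
      (E.castFiber (hσ (p b)).symm).toLinearMap) = F b := by
    intro b
    refine LinearMap.ext fun e => ?_
    change E'.castFiber (hσ (p b)) (F (σ (p b)) (E.castFiber (hσ (p b)).symm e)) = F b e
    rw [hcast (hσ (p b)).symm e, castFiber_castFiber, castFiber_rfl]
  refine ⟨fun x => (E'.castFiber (hσ x)).toLinearMap.comp ((F (σ x)).comp
    (E.castFiber (hσ x).symm).toLinearMap), ?_, hfF⟩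
  intro c hc d hd i j x ⟨hxc, hxd⟩
  obtain ⟨U, s, hU, hxU, hs, hps⟩ := ha.local_section x
  refine ContMDiffAt.contMDiffWithinAt ?_
  have hO : IsOpen (p ⁻¹' (c.dom ∩ d.dom)) :=
    ((hE.isOpen_dom c hc).inter (hE'.isOpen_dom d hd)).preimage ha.smooth_proj.continuous
  -- Smoothness must not be tested at `σ`, which may be discontinuous; constancy along fibres allows
  -- `F` to be evaluated at `s y` instead.
  have h₁ := (hF.1 _ ⟨c, hc, rfl⟩ _ ⟨d, hd, rfl⟩ i j).contMDiffAt (x := s x)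
    (hO.mem_nhds (by simpa [hps x hxU] using ⟨hxc, hxd⟩))
  refine (ContMDiffAt.comp (f := s) x h₁ (hs.contMDiffAt (hU.mem_nhds hxU))).congr_of_eventuallyEq ?_
  filter_upwards [hU.mem_nhds hxU] with y hy
  have key : ∀ (b : B) (y : V), p b = y → d.coord i y (E'.castFiber (hσ y)
      (F (σ y) (E.castFiber (hσ y).symm (c.vec j y)))) =
      d.coord i (p b) (F b (c.vec j (p b))) := by
    rintro b _ rfl
    exact congrArg (d.coord i (p b)) (LinearMap.congr_fun (hfF b) _)
  exact key _ _ (hps y hy)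

end FramedFamily

namespace EquivariantFamily

variable {p : B → V} {a : Γ → B → B} {W : EquivariantFamily.{w} a} {σ : V → B}

/-- Acting by `g` is itself a transport, so both sides of the equivariance equation are the
transport from `b` to `σ (p b')`. -/
theorem isEquivariantHom_to_descend (ha : IsQuotientAction IV IB IΓ p a) (hW : W.IsBundle IB IΓ)
    (h₀ : W.TrivialIsotropy) (hσ : ∀ x, p (σ x) = x) :
    W.IsEquivariantHom IB ((W.descend IV IB p σ).equivariantPullback ha.proj_act)
      fun b => W.transport b (σ (p b)) := by
  refine ⟨isSmoothHom_to_descend ha hW h₀ hσ, fun g b b' h e => ?_⟩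
  have h₁ : p b = p b' := by rw [h, ha.proj_act]
  refine (transport_act ha hW h₀ h (h₁.trans (hσ _).symm) e).trans ?_
  refine Eq.trans ?_ (castFiber_descend ha hW h₀ h₁ _).symm
  exact (transport_transport ha hW h₀ (hσ _).symm
    ((hσ _).trans (h₁.trans (hσ _).symm)) e).symm

theorem isEquivariantHom_of_descend (ha : IsQuotientAction IV IB IΓ p a) (hW : W.IsBundle IB IΓ)
    (h₀ : W.TrivialIsotropy) (hσ : ∀ x, p (σ x) = x) :
    ((W.descend IV IB p σ).equivariantPullback ha.proj_act).IsEquivariantHom IB W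
      fun b => W.transport (σ (p b)) b := by
  refine ⟨isSmoothHom_of_descend ha hW h₀ hσ, fun g b b' h e => ?_⟩
  have h₁ : p b = p b' := by rw [h, ha.proj_act]
  refine (congrArg (W.transport (σ (p b')) b') (castFiber_descend ha hW h₀ h₁ e)).trans ?_
  rw [← transport_eq ha hW h₀ h]
  refine (transport_transport ha hW h₀ ((hσ _).trans (h₁.trans (hσ _).symm)) (hσ _) e).trans ?_
  exact (transport_transport ha hW h₀ (hσ _) h₁ e).symm

end EquivariantFamily

end Descent

/-! ### The lifted action on a principal bundle and its isotropy -/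

section Lifting

variable {k : ℕ}
  {EV HV : Type*} [NormedAddCommGroup EV] [NormedSpace ℝ EV] [TopologicalSpace HV]
  {IV : ModelWithCorners ℝ EV HV}
  {V : Type v} [TopologicalSpace V] [ChartedSpace HV V] [IsManifold IV ∞ V]
  {EB HB : Type*} [NormedAddCommGroup EB] [NormedSpace ℝ EB] [TopologicalSpace HB]
  {IB : ModelWithCorners ℝ EB HB}
  {B : Type u} [TopologicalSpace B] [ChartedSpace HB B] [IsManifold IB ∞ B]

/-- Two points of a fibre of a principal bundle differ by an element of the structure group which
depends smoothly on them. -/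
theorem PrincipalBundle.exists_smooth_division {EG HG : Type*} [NormedAddCommGroup EG]
    [NormedSpace ℝ EG] [TopologicalSpace HG] {IG : ModelWithCorners ℝ EG HG}
    {G : Type*} [TopologicalSpace G] [ChartedSpace HG G] [Group G] [LieGroup IG ∞ G]
    (P : PrincipalBundle IV IB IG V B G) {b b' : B} (h : P.proj b = P.proj b') :
    ∃ θ : B × B → G, ContMDiffAt (IB.prod IB) IG ∞ θ (b, b') ∧
      ∀ᶠ q in 𝓝 (b, b'), P.proj q.1 = P.proj q.2 → P.act q.1 (θ q)⁻¹ = q.2 := by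
  obtain ⟨U, s, φ, hU, hb, -, hφ, -, hact⟩ := P.locally_trivial (P.proj b)
  have hO : IsOpen (P.proj ⁻¹' U) := hU.preimage P.smooth_proj.continuous
  have hb' : b' ∈ P.proj ⁻¹' U := by rwa [Set.mem_preimage, ← h]
  have h₁ : ContMDiffAt (IB.prod IB) IG ∞ (fun q : B × B => φ q.1) (b, b') :=
    ContMDiffAt.comp (g := φ) (b, b') (hφ.contMDiffAt (hO.mem_nhds hb)) contMDiffAt_fst
  have h₂ : ContMDiffAt (IB.prod IB) IG ∞ (fun q : B × B => φ q.2) (b, b') :=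
    ContMDiffAt.comp (g := φ) (b, b') (hφ.contMDiffAt (hO.mem_nhds hb')) contMDiffAt_snd
  -- In the trivialization `q.1 = s · φ q.1` and `q.2 = s · φ q.2` over a common base point, so `q.1
  -- · (φ q.1)⁻¹ · φ q.2 = q.2`; the inverse matches the convention of `liftedAction`.
  refine ⟨fun q => (φ q.2)⁻¹ * φ q.1, h₂.inv.mul h₁, ?_⟩
  filter_upwards [(hO.preimage continuous_fst).mem_nhds (x := (b, b')) hb,
    (hO.preimage continuous_snd).mem_nhds (x := (b, b')) hb'] with q hq hq' hqq
  obtain ⟨h₃, -⟩ := hact q.1 hq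
  obtain ⟨h₄, -⟩ := hact q.2 hq'
  have h₅ : P.act q.1 (φ q.1)⁻¹ = s (P.proj q.1) := by
    conv_lhs => rw [← h₃]
    rw [← P.act_mul]
    rw [h₃, mul_inv_cancel, P.act_one]
  rw [mul_inv_rev, inv_inv, P.act_mul, h₅, hqq, h₄]

/-- The action of the structure group is free. -/
theorem PrincipalBundle.eq_one_of_act_eq {EG HG : Type*} [NormedAddCommGroup EG]
    [NormedSpace ℝ EG] [TopologicalSpace HG] {IG : ModelWithCorners ℝ EG HG}
    {G : Type*} [TopologicalSpace G] [ChartedSpace HG G] [Group G] [LieGroup IG ∞ G]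
    (P : PrincipalBundle IV IB IG V B G) {b : B} {g : G} (h : P.act b g = b) : g = 1 := by
  obtain ⟨U, s, φ, -, hb, -, -, -, hact⟩ := P.locally_trivial (P.proj b)
  have h₁ := (hact b hb).2 g
  rw [h] at h₁
  exact mul_eq_left.mp h₁.symm

/-- A covering may have no global section, but its local inverse around a chosen preimage of `g`
suffices. -/
theorem CentralExtension.exists_smooth_lift {E₃ : Type*} [NormedAddCommGroup E₃]
    [NormedSpace ℝ E₃] {Gc : Type*} [TopologicalSpace Gc] [ChartedSpace E₃ Gc] [Group Gc]
    [LieGroup 𝓘(ℝ, E₃) ∞ Gc] {E₁ : Type*} [NormedAddCommGroup E₁] [NormedSpace ℝ E₁]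
    {G : Type*} [TopologicalSpace G] [ChartedSpace E₁ G] [Group G] [LieGroup 𝓘(ℝ, E₁) ∞ G]
    (e : CentralExtension k E₃ Gc E₁ G) (g : G) :
    ∃ l : G → Gc, ContMDiffAt 𝓘(ℝ, E₁) 𝓘(ℝ, E₃) ∞ l g ∧ ∀ᶠ x in 𝓝 g, e.pr (l x) = x := by
  obtain ⟨g', rfl⟩ := e.pr_surjective g
  have h := e.pr_localDiffeo g'
  exact ⟨h.localInverse, h.localInverse_contMDiffAt, h.localInverse_eventuallyEq_right⟩

variable {E₁ : Type*} [NormedAddCommGroup E₁] [NormedSpace ℝ E₁]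
  {Gh : Type*} [TopologicalSpace Gh] [ChartedSpace E₁ Gh] [Group Gh] [LieGroup 𝓘(ℝ, E₁) ∞ Gh]
  {E₂ : Type*} [NormedAddCommGroup E₂] [NormedSpace ℝ E₂]
  {Gv : Type*} [TopologicalSpace Gv] [ChartedSpace E₂ Gv] [Group Gv] [LieGroup 𝓘(ℝ, E₂) ∞ Gv]
  {E₃ : Type*} [NormedAddCommGroup E₃] [NormedSpace ℝ E₃]
  {Gch : Type*} [TopologicalSpace Gch] [ChartedSpace E₃ Gch] [Group Gch]
  [LieGroup 𝓘(ℝ, E₃) ∞ Gch]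
  {E₄ : Type*} [NormedAddCommGroup E₄] [NormedSpace ℝ E₄]
  {Gcv : Type*} [TopologicalSpace Gcv] [ChartedSpace E₄ Gcv] [Group Gcv]
  [LieGroup 𝓘(ℝ, E₄) ∞ Gcv]
  {eh : CentralExtension k E₃ Gch E₁ Gh} {ev : CentralExtension k E₄ Gcv E₂ Gv}
  {P : PrincipalBundle IV IB (𝓘(ℝ, E₁).prod 𝓘(ℝ, E₂)) V B (Gh × Gv)}

/-- The `local_lift` clause carries the content: the smooth division in `Gh × Gv` is lifted in each
component through the local inverse of its covering. The inverse in `liftedAction` turns the right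
action into a left one. -/
theorem isQuotientAction_liftedAction :
    IsQuotientAction IV IB (𝓘(ℝ, E₃).prod 𝓘(ℝ, E₄)) P.proj (liftedAction eh ev P) where
  one b := by
    have h : ((eh.pr 1, ev.pr 1) : Gh × Gv)⁻¹ = 1 := by simp
    exact (congrArg (P.act b) h).trans (P.act_one b)
  mul g g' b := by
    have h : ((eh.pr (g * g').1, ev.pr (g * g').2) : Gh × Gv)⁻¹ =
        (eh.pr g'.1, ev.pr g'.2)⁻¹ * (eh.pr g.1, ev.pr g.2)⁻¹ := by simp
    exact (congrArg (P.act b) h).trans (P.act_mul b _ _)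
  proj_act _ _ := P.proj_act _ _
  smooth_proj := P.smooth_proj
  smooth_act := by
    have h₁ : ContMDiff 𝓘(ℝ, E₃) 𝓘(ℝ, E₁) ∞ eh.pr := eh.pr_localDiffeo.contMDiff
    have h₂ : ContMDiff 𝓘(ℝ, E₄) 𝓘(ℝ, E₂) ∞ ev.pr := ev.pr_localDiffeo.contMDiff
    have h₃ : ContMDiff (𝓘(ℝ, E₃).prod 𝓘(ℝ, E₄)) (𝓘(ℝ, E₁).prod 𝓘(ℝ, E₂)) ∞
        (fun g : Gch × Gcv => (eh.pr g.1, ev.pr g.2)⁻¹) :=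
      ((h₁.comp contMDiff_fst).prodMk (h₂.comp contMDiff_snd)).inv
    exact P.smooth_act.comp (contMDiff_snd.prodMk (h₃.comp contMDiff_fst))
  local_section x := by
    obtain ⟨U, s, φ, hU, hx, hs, -, h, -⟩ := P.locally_trivial x
    exact ⟨U, s, hU, hx, hs, fun y hy => (h y hy).1⟩
  local_lift b b' h := by
    obtain ⟨θ, hθ, hθ'⟩ := P.exists_smooth_division h
    obtain ⟨l₁, hl₁, hl₁'⟩ := eh.exists_smooth_lift (θ (b, b')).1
    obtain ⟨l₂, hl₂, hl₂'⟩ := ev.exists_smooth_lift (θ (b, b')).2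
    have hθ₁ := hθ.fst
    have hθ₂ := hθ.snd
    refine ⟨fun q => (l₁ (θ q).1, l₂ (θ q).2), (ContMDiffAt.comp (b, b') hl₁ hθ₁).prodMk
      (ContMDiffAt.comp (b, b') hl₂ hθ₂), ?_⟩
    filter_upwards [hθ', hθ₁.continuousAt.eventually hl₁', hθ₂.continuousAt.eventually hl₂']
      with q hq hq₁ hq₂ hp
    change P.act q.1 (eh.pr (l₁ (θ q).1), ev.pr (l₂ (θ q).2))⁻¹ = q.2
    rw [hq₁, hq₂]
    exact hq hp

/-- Freeness forces the image of `g` in `Gh × Gv` to be `1`, and exactness puts each component in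
the range of `incl`. -/
theorem exists_incl_of_liftedAction_eq {g : Gch × Gcv} {b : B} (h : b = liftedAction eh ev P g b) :
    ∃ z z' : rootsOfUnity k ℂ, g = (eh.incl z, ev.incl z') := by
  have h₁ : ((eh.pr g.1, ev.pr g.2) : Gh × Gv) = 1 :=
    inv_eq_one.mp (P.eq_one_of_act_eq h.symm)
  have hh : g.1 ∈ eh.incl.range := by
    rw [← eh.exact]
    exact congrArg Prod.fst h₁
  have hv : g.2 ∈ ev.incl.range := by
    rw [← ev.exact]
    exact congrArg Prod.snd h₁
  obtain ⟨z, hz⟩ := hh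
  obtain ⟨z', hz'⟩ := hv
  exact ⟨z, z', Prod.ext hz.symm hz'.symm⟩

/-- Here weight zero enters the descent: an isotropy element acts by `z ^ 0 = 1`. -/
theorem IsPsiModule.trivialIsotropy_h {W : EquivariantDFamily.{w} (liftedAction eh ev P)}
    (hW : IsPsiModule eh ev P 0 W) : W.h.TrivialIsotropy := by
  intro g b h e
  obtain ⟨z, z', rfl⟩ := exists_incl_of_liftedAction_eq h
  simpa using hW.weight_h z z' b h e

theorem IsPsiModule.trivialIsotropy_v {W : EquivariantDFamily.{w} (liftedAction eh ev P)}
    (hW : IsPsiModule eh ev P 0 W) : W.v.TrivialIsotropy := by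
  intro g b h e
  obtain ⟨z, z', rfl⟩ := exists_incl_of_liftedAction_eq h
  simpa using hW.weight_v z z' b h e

/-! ## Modules and d-bundles -/

theorem isPsiModule_pullbackModule {E : DFamily.{v, w} V} (hE : E.IsBundle IV) :
    IsPsiModule eh ev P 0 (pullbackModule eh ev P E) where
  isBundle_h := FramedFamily.isBundle_equivariantPullback isQuotientAction_liftedAction hE.1
  isBundle_v := FramedFamily.isBundle_equivariantPullback isQuotientAction_liftedAction hE.2
  weight_h _ _ _ _ e := by
    -- What remains is `castFiber` along an equality of a point with itself, which is definitionally
    -- the identity.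
    rw [zpow_zero, one_smul]
    rfl
  weight_v _ _ _ _ e := by
    rw [zpow_zero, one_smul]
    rfl

theorem IsPsiModule.exists_isomorphic_pullbackModule
    {W : EquivariantDFamily.{w} (liftedAction eh ev P)} (hW : IsPsiModule eh ev P 0 W) :
    ∃ E : DFamily.{v, w} V, E.IsBundle IV ∧ W.Isomorphic IB (pullbackModule eh ev P E) := by
  have ha : IsQuotientAction IV IB (𝓘(ℝ, E₃).prod 𝓘(ℝ, E₄)) P.proj (liftedAction eh ev P) :=
    isQuotientAction_liftedAction
  -- One `σ` serves both components; it is chosen pointwise, since a global smooth section need not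
  -- exist.
  choose σ hσ using ha.surjective
  have hh := hW.trivialIsotropy_h
  have hv := hW.trivialIsotropy_v
  refine ⟨⟨W.h.descend IV IB P.proj σ, W.v.descend IV IB P.proj σ⟩,
    ⟨EquivariantFamily.isBundle_descend ha hW.isBundle_h hh hσ,
      EquivariantFamily.isBundle_descend ha hW.isBundle_v hv hσ⟩,
    ⟨fun b => W.h.transport b (σ (P.proj b)), fun b => W.v.transport b (σ (P.proj b))⟩,
    ⟨fun b => W.h.transport (σ (P.proj b)) b, fun b => W.v.transport (σ (P.proj b)) b⟩,
    ⟨EquivariantFamily.isEquivariantHom_to_descend ha hW.isBundle_h hh hσ,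
      EquivariantFamily.isEquivariantHom_to_descend ha hW.isBundle_v hv hσ⟩,
    ⟨EquivariantFamily.isEquivariantHom_of_descend ha hW.isBundle_h hh hσ,
      EquivariantFamily.isEquivariantHom_of_descend ha hW.isBundle_v hv hσ⟩,
    fun b => ⟨fun e => ?_, fun e => ?_⟩, fun b => ⟨fun e => ?_, fun e => ?_⟩⟩
  · exact (EquivariantFamily.transport_transport ha hW.isBundle_h hh (hσ _).symm (hσ _) e).trans
      (EquivariantFamily.transport_self ha hW.isBundle_h hh b e)
  · exact (EquivariantFamily.transport_transport ha hW.isBundle_h hh (hσ _) (hσ _).symm e).trans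
      (EquivariantFamily.transport_self ha hW.isBundle_h hh _ e)
  · exact (EquivariantFamily.transport_transport ha hW.isBundle_v hv (hσ _).symm (hσ _) e).trans
      (EquivariantFamily.transport_self ha hW.isBundle_v hv b e)
  · exact (EquivariantFamily.transport_transport ha hW.isBundle_v hv (hσ _) (hσ _).symm e).trans
      (EquivariantFamily.transport_self ha hW.isBundle_v hv _ e)

theorem isEquivariantHom_pullbackHom {E : DFamily.{v, w₁} V} {E' : DFamily.{v, w₂} V}
    {f : E.Hom E'} (hf : DFamily.IsSmoothHom IV f) :
    EquivariantDFamily.IsEquivariantHom IB (W := pullbackModule eh ev P E)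
      (W' := pullbackModule eh ev P E') (pullbackHom eh ev P f) :=
  ⟨FramedFamily.isEquivariantHom_pullback isQuotientAction_liftedAction hf.1,
    FramedFamily.isEquivariantHom_pullback isQuotientAction_liftedAction hf.2⟩

theorem exists_pullbackHom_eq {E : DFamily.{v, w₁} V} {E' : DFamily.{v, w₂} V}
    (hE : E.IsBundle IV) (hE' : E'.IsBundle IV)
    {F : (pullbackModule eh ev P E).toDFamily.Hom (pullbackModule eh ev P E').toDFamily}
    (hF : EquivariantDFamily.IsEquivariantHom IB (W := pullbackModule eh ev P E)
      (W' := pullbackModule eh ev P E') F) :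
    ∃ f : E.Hom E', DFamily.IsSmoothHom IV f ∧ pullbackHom eh ev P f = F := by
  obtain ⟨fh, hfh, hh⟩ := FramedFamily.exists_eq_pullback
    (isQuotientAction_liftedAction (eh := eh) (ev := ev) (P := P)) hE.1 hE'.1 hF.1
  obtain ⟨fv, hfv, hv⟩ := FramedFamily.exists_eq_pullback
    (isQuotientAction_liftedAction (eh := eh) (ev := ev) (P := P)) hE.2 hE'.2 hF.2
  refine ⟨⟨fh, fv⟩, ⟨hfh, hfv⟩, ?_⟩
  obtain ⟨Fh, Fv⟩ := F
  exact congrArg₂ DFamily.Hom.mk (funext hh) (funext hv)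

theorem bijOn_pullbackHom {E : DFamily.{v, w₁} V} {E' : DFamily.{v, w₂} V}
    (hE : E.IsBundle IV) (hE' : E'.IsBundle IV) :
    Set.BijOn (pullbackHom eh ev P) {f : E.Hom E' | DFamily.IsSmoothHom IV f}
      {F | EquivariantDFamily.IsEquivariantHom IB (W := pullbackModule eh ev P E)
        (W' := pullbackModule eh ev P E') F} := by
  refine ⟨fun f hf => isEquivariantHom_pullbackHom hf, fun f _ f' _ h => ?_,
    fun F hF => exists_pullbackHom_eq hE hE' hF⟩
  have hsurj := (isQuotientAction_liftedAction (eh := eh) (ev := ev) (P := P)).surjective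
  obtain ⟨fh, fv⟩ := f
  obtain ⟨fh', fv'⟩ := f'
  rw [DFamily.Hom.mk.injEq]
  refine ⟨funext fun x => ?_, funext fun x => ?_⟩ <;> obtain ⟨b, rfl⟩ := hsurj x
  · exact congrFun (congrArg DFamily.Hom.h h) b
  · exact congrFun (congrArg DFamily.Hom.v h) b

theorem isomorphic_iff_pullbackModule {E : DFamily.{v, w₁} V} {E' : DFamily.{v, w₂} V}
    (hE : E.IsBundle IV) (hE' : E'.IsBundle IV) :
    E.Isomorphic IV E' ↔
      (pullbackModule eh ev P E).Isomorphic IB (pullbackModule eh ev P E') := by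
  constructor
  · rintro ⟨f, g, hf, hg, hh, hv⟩
    exact ⟨pullbackHom eh ev P f, pullbackHom eh ev P g, isEquivariantHom_pullbackHom hf,
      isEquivariantHom_pullbackHom hg, fun b => hh _, fun b => hv _⟩
  · rintro ⟨F, F', hF, hF', hh, hv⟩
    have hsurj := (isQuotientAction_liftedAction (eh := eh) (ev := ev) (P := P)).surjective
    -- Both maps of the inverse pair descend; since `P.proj` is surjective, that they are mutually
    -- inverse can be checked on points `P.proj b`.
    obtain ⟨f, hf, rfl⟩ := exists_pullbackHom_eq hE hE' hF
    obtain ⟨g, hg, rfl⟩ := exists_pullbackHom_eq hE' hE hF'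
    refine ⟨f, g, hf, hg, fun x => ?_, fun x => ?_⟩ <;> obtain ⟨b, rfl⟩ := hsurj x
    · exact hh b
    · exact hv b

/-! ## Operations on modules -/

/-- Scalars commute with `f`. Writing vectors as `T e` avoids inverting `t`, which may vanish if `F`
is zero. -/
theorem conj_eq_self_of_smul {F : Type*} [AddCommGroup F] [Module ℂ F] {T : F ≃ₗ[ℂ] F} {t : ℂ}
    (hT : ∀ e, T e = t • e) (f : F →ₗ[ℂ] F) : T.conj f = f := by
  refine LinearMap.ext fun e => ?_
  obtain ⟨e, rfl⟩ := T.surjective e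
  rw [LinearEquiv.conj_apply_apply, LinearEquiv.symm_apply_apply, hT, hT, map_smul]

/-- This makes weights additive: `z ^ q₁` and `z ^ q₂` multiply to `z ^ (q₁ + q₂)`. -/
theorem tensor_congr_eq_smul {F F' : Type*} [AddCommGroup F] [Module ℂ F] [AddCommGroup F']
    [Module ℂ F'] {T : F ≃ₗ[ℂ] F} {T' : F' ≃ₗ[ℂ] F'} {t t' : ℂ} (hT : ∀ e, T e = t • e)
    (hT' : ∀ e, T' e = t' • e) (e : F ⊗[ℂ] F') : TensorProduct.congr T T' e = (t * t') • e := by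
  induction e using TensorProduct.induction_on with
  | zero => simp
  | add e₁ e₂ h₁ h₂ => rw [map_add, h₁, h₂, smul_add]
  | tmul e e' => rw [TensorProduct.congr_tmul, hT, hT', TensorProduct.smul_tmul_smul]

theorem IsPsiModule.nEnd {q : ℤ} {W : EquivariantDFamily.{w} (liftedAction eh ev P)}
    (hW : IsPsiModule eh ev P q W) : IsPsiModule eh ev P 0 W.nEnd where
  isBundle_h := by
    have ha := isQuotientAction_liftedAction (eh := eh) (ev := ev) (P := P)
    exact EquivariantFamily.isBundle_endo ha.smooth_act ha.one ha.mul hW.isBundle_h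
  isBundle_v := by
    have ha := isQuotientAction_liftedAction (eh := eh) (ev := ev) (P := P)
    exact EquivariantFamily.isBundle_endo ha.smooth_act ha.one ha.mul hW.isBundle_v
  weight_h z z' b hb f := by
    rw [zpow_zero, one_smul]
    exact conj_eq_self_of_smul (hW.weight_h z z' b hb) f
  weight_v z z' b hb f := by
    rw [zpow_zero, one_smul]
    exact conj_eq_self_of_smul (hW.weight_v z z' b hb) f

theorem IsPsiModule.sum {q : ℤ} {W₁ : EquivariantDFamily.{w₁} (liftedAction eh ev P)}
    {W₂ : EquivariantDFamily.{w₂} (liftedAction eh ev P)} (h₁ : IsPsiModule eh ev P q W₁)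
    (h₂ : IsPsiModule eh ev P q W₂) : IsPsiModule eh ev P q (W₁.sum W₂) where
  isBundle_h := EquivariantFamily.isBundle_sum h₁.isBundle_h h₂.isBundle_h
  isBundle_v := EquivariantFamily.isBundle_sum h₁.isBundle_v h₂.isBundle_v
  weight_h z z' b hb e :=
    Prod.ext (h₁.weight_h z z' b hb e.1) (h₂.weight_h z z' b hb e.2)
  weight_v z z' b hb e :=
    Prod.ext (h₁.weight_v z z' b hb e.1) (h₂.weight_v z z' b hb e.2)

theorem IsPsiModule.dTensor {q₁ q₂ : ℤ} {W₁ : EquivariantDFamily.{w₁} (liftedAction eh ev P)}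
    {W₂ : EquivariantDFamily.{w₂} (liftedAction eh ev P)} (h₁ : IsPsiModule eh ev P q₁ W₁)
    (h₂ : IsPsiModule eh ev P q₂ W₂) : IsPsiModule eh ev P (q₁ + q₂) (W₁.dTensor W₂) where
  isBundle_h := EquivariantFamily.isBundle_tensor h₁.isBundle_h h₂.isBundle_h
  isBundle_v := EquivariantFamily.isBundle_tensor h₁.isBundle_v h₂.isBundle_v
  weight_h z z' b hb e := by
    rw [zpow_add₀ (Units.ne_zero _)]
    exact tensor_congr_eq_smul (h₁.weight_h z z' b hb) (h₂.weight_h z z' b hb) e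
  weight_v z z' b hb e := by
    rw [zpow_add₀ (Units.ne_zero _)]
    exact tensor_congr_eq_smul (h₁.weight_v z z' b hb) (h₂.weight_v z z' b hb) e

end Lifting

end NGerbe

theorem mainTheorem11
    (n m : ℕ)
    {V : Type v} [TopologicalSpace V] [ChartedSpace (EuclideanSpace ℝ (Fin (n + m))) V]
    [IsManifold (𝓡 (n + m)) ∞ V]
    (_N : NGerbe.NConnection n m V)
    {k : ℕ} [NeZero k]
    {E₁ : Type*} [NormedAddCommGroup E₁] [NormedSpace ℝ E₁] [FiniteDimensional ℝ E₁]
    {Gh : Type*} [TopologicalSpace Gh] [ChartedSpace E₁ Gh] [Group Gh]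
    [LieGroup 𝓘(ℝ, E₁) ∞ Gh]
    {E₂ : Type*} [NormedAddCommGroup E₂] [NormedSpace ℝ E₂] [FiniteDimensional ℝ E₂]
    {Gv : Type*} [TopologicalSpace Gv] [ChartedSpace E₂ Gv] [Group Gv]
    [LieGroup 𝓘(ℝ, E₂) ∞ Gv]
    {E₃ : Type*} [NormedAddCommGroup E₃] [NormedSpace ℝ E₃] [FiniteDimensional ℝ E₃]
    {Gch : Type*} [TopologicalSpace Gch] [ChartedSpace E₃ Gch] [Group Gch]
    [LieGroup 𝓘(ℝ, E₃) ∞ Gch]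
    {E₄ : Type*} [NormedAddCommGroup E₄] [NormedSpace ℝ E₄] [FiniteDimensional ℝ E₄]
    {Gcv : Type*} [TopologicalSpace Gcv] [ChartedSpace E₄ Gcv] [Group Gcv]
    [LieGroup 𝓘(ℝ, E₄) ∞ Gcv]
    (eh : NGerbe.CentralExtension k E₃ Gch E₁ Gh) (ev : NGerbe.CentralExtension k E₄ Gcv E₂ Gv)
    {EB : Type*} [NormedAddCommGroup EB] [NormedSpace ℝ EB] [FiniteDimensional ℝ EB]
    {B : Type u} [TopologicalSpace B] [ChartedSpace EB B] [IsManifold 𝓘(ℝ, EB) ∞ B]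
    (P : NGerbe.PrincipalBundle (𝓡 (n + m)) 𝓘(ℝ, EB) (𝓘(ℝ, E₁).prod 𝓘(ℝ, E₂)) V B (Gh × Gv)) :
    -- weight-zero modules and d-bundles on `V` are in bijective correspondence
    ((∀ E : NGerbe.DFamily.{v, w} V, E.IsBundle (𝓡 (n + m)) →
        NGerbe.IsPsiModule eh ev P 0 (NGerbe.pullbackModule eh ev P E)) ∧
      (∀ W : NGerbe.EquivariantDFamily.{w} (NGerbe.liftedAction eh ev P),
        NGerbe.IsPsiModule eh ev P 0 W →
        ∃ E : NGerbe.DFamily.{v, w} V, E.IsBundle (𝓡 (n + m)) ∧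
          W.Isomorphic 𝓘(ℝ, EB) (NGerbe.pullbackModule eh ev P E)) ∧
      (∀ E E' : NGerbe.DFamily.{v, w} V, E.IsBundle (𝓡 (n + m)) → E'.IsBundle (𝓡 (n + m)) →
        (E.Isomorphic (𝓡 (n + m)) E' ↔
          (NGerbe.pullbackModule eh ev P E).Isomorphic 𝓘(ℝ, EB)
            (NGerbe.pullbackModule eh ev P E')) ∧
        Set.BijOn (NGerbe.pullbackHom eh ev P)
          {f : E.Hom E' | NGerbe.DFamily.IsSmoothHom (𝓡 (n + m)) f}
          {F | NGerbe.EquivariantDFamily.IsEquivariantHom 𝓘(ℝ, EB)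
            (W := NGerbe.pullbackModule eh ev P E) (W' := NGerbe.pullbackModule eh ev P E') F})) ∧
    -- N-adapted endomorphisms
    (∀ (q : ℤ) (W : NGerbe.EquivariantDFamily.{w} (NGerbe.liftedAction eh ev P)),
      NGerbe.IsPsiModule eh ev P q W → NGerbe.IsPsiModule eh ev P 0 W.nEnd) ∧
    -- direct sums
    (∀ (q : ℤ) (W₁ : NGerbe.EquivariantDFamily.{w₁} (NGerbe.liftedAction eh ev P))
      (W₂ : NGerbe.EquivariantDFamily.{w₂} (NGerbe.liftedAction eh ev P)),
      NGerbe.IsPsiModule eh ev P q W₁ → NGerbe.IsPsiModule eh ev P q W₂ →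
      NGerbe.IsPsiModule eh ev P q (W₁.sum W₂)) ∧
    -- d-tensor products
    (∀ (q₁ q₂ : ℤ) (W₁ : NGerbe.EquivariantDFamily.{w₁} (NGerbe.liftedAction eh ev P))
      (W₂ : NGerbe.EquivariantDFamily.{w₂} (NGerbe.liftedAction eh ev P)),
      NGerbe.IsPsiModule eh ev P q₁ W₁ → NGerbe.IsPsiModule eh ev P q₂ W₂ →
      NGerbe.IsPsiModule eh ev P (q₁ + q₂) (W₁.dTensor W₂)) := by
  refine ⟨⟨fun E hE => NGerbe.isPsiModule_pullbackModule hE,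
    fun W hW => hW.exists_isomorphic_pullbackModule,
    fun E E' hE hE' => ⟨NGerbe.isomorphic_iff_pullbackModule hE hE',
      NGerbe.bijOn_pullbackHom hE hE'⟩⟩,
    fun q W hW => hW.nEnd, fun q W₁ W₂ h₁ h₂ => h₁.sum h₂,
    fun q₁ q₂ W₁ W₂ h₁ h₂ => h₁.dTensor h₂⟩
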